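/- For $n\in\mathbb N=\{1,2,\ldots\}$ and $p\in[0,1]$ let $G(n,p)$ be the Erdős–Rényi random graph on $n$ vertices, in which each of the $\binom n2$ possible edges is present with probability $p$, independently of the others. For real random variables $X,Y$ let $d_K(X,Y)=\sup_{x\in\mathbb R}|P(X\le x)-P(Y\le x)|$ be the Kolmogorov distance, and let $N\sim\mathcal N(0,1)$. Fix $d\in\{0,1,2,\ldots\}$ and $\alpha\in[1,2)$, let $(\theta_n)_{n\ge 1}$ be a real sequence with $0<\theta_n<n^{\alpha}$ for all $n\geq 1$ and $\theta_n\asymp 1$ (that is, there are constants $0<c\le C<\infty$ with $c\le\theta_n\le C$ for all sufficiently large $n$), and put $p=p_n=\theta_n n^{-\alpha}$. Let $V_{n,d}$ be the number of vertices of degree $d$ in $G(n,p_n)$ and let $G_{n,d}=(V_{n,d}-\mathbb E[V_{n,d}])/\sqrt{\operatorname{Var}[V_{n,d}]}$. Then, as $n\to\infty$, $$d_K(G_{n,d},N)=\begin{cases}\mathcal O\big(n^{-1+\alpha/2}\big)&\text{if } d=0 \text{ and } \alpha\in[1,2),\\[2pt] \mathcal O\big(n^{1/2-3d/2-\alpha+3\alpha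 d/2}\big)&\text{if } d\ge 1\text{ and }\alpha\in\big[1,\tfrac{3d-1}{3d-2}\big).\end{cases}$$ In particular, if $\alpha=1$, then $d_K(G_{n,d},N)=\mathcal O(n^{-1/2})$ for all $d\in\{0,1,2,\ldots\}$. -/

import Mathlib

open MeasureTheory ProbabilityTheory Filter Asymptotics
open scoped Topology SimpleGraph

noncomputable section

/-- The Kolmogorov distance `sup_x |P(X ≤ x) - P(Y ≤ x)|` between a real random variable `X` on
`(Ω, μ)` and a real random variable `Y` on `(Ω', ν)`. -/
def kolmogorovDist {Ω Ω' : Type*} [MeasurableSpace Ω] [MeasurableSpace Ω']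
    (X : Ω → ℝ) (μ : Measure Ω) (Y : Ω' → ℝ) (ν : Measure Ω') : ℝ :=
  ⨆ x : ℝ, |μ.real {ω | X ω ≤ x} - ν.real {ω | Y ω ≤ x}|

/-- The normalized random variable `(X - E[X]) / √Var[X]`. -/
def normalizedVar {Ω : Type*} [MeasurableSpace Ω] (X : Ω → ℝ) (μ : Measure Ω) : Ω → ℝ :=
  fun ω => (X ω - ∫ ω', X ω' ∂μ) / √(variance X μ)

open Classical in
/-- The number of vertices of degree `d` of a graph on `n` vertices. -/
def degreeCount (n d : ℕ) (G : SimpleGraph (Fin n)) : ℝ :=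
  ((Finset.univ.filter fun v : Fin n => G.degree v = d).card : ℝ)

/-- The Kolmogorov distance to `N` of the normalized number of vertices of degree `d` in the
Erdős–Rényi random graph on `n` vertices with edge probability `p`. The law of the random graph is
Mathlib's `SimpleGraph.binomialRandom`, which gives mass `p ^ e(G) * (1 - p) ^ (n.choose 2 - e(G))`
to each graph `G`. -/
def degreeCountDist (n d : ℕ) (p : unitInterval) {Ω : Type*} [MeasurableSpace Ω]
    (N : Ω → ℝ) (P : Measure Ω) : ℝ :=
  kolmogorovDist
    (normalizedVar (degreeCount n d) (SimpleGraph.binomialRandom (Fin n) p))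
    (SimpleGraph.binomialRandom (Fin n) p) N P

end

/-! The proof is Stein's method with block resampling. Write the count as X = ∑ I_v, where I_v
depends only on the block of edges at v. Let S^v be the edge set S with this block replaced by that
of an independent copy T. Exchanging the blocks preserves the joint law of S and T, so Cov(I_v, g) =
½ E[(I_v(S) − I_v(T)) (g(S) − g(S^v))], although the blocks of different vertices overlap.

Take g = f(W), with W the normalized count and f the bounded solution of Stein's equation for a
half-line. Replacing f(W) − f(W^v) by (W − W^v) f'(W) turns E[W f(W)] into E[f'(W) Y / (2s²)], where
s² = Var X and Y = ∑ E_T[(I_v(S) − I_v(T))(X − X^v)] has mean 2s². Since w f(w) is monotone, the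
error is at most (W − W^v)(k(W) − k(W^v)) with k(w) = w f(w) − 1_{w ≤ z}. By exchangeability its
weighted mean is expressed through E[k(W) R], where R is Y with the weights |I_v(S) − I_v(T)|. As k
is bounded and R has mean zero, only the standard deviations of Y and R enter, and no smoothing or
concentration inequality is needed (`abs_bernoulliMean_sub_gaussianCDF_le`).

Both variances are bounded by the Efron-Stein inequality: changing one edge alters Y or R by a
multiple of 1 + np + the degrees of its two endpoints, so the variances are O(n²p) when np is
bounded (`variance_resamplingSum_le`). Conversely, indicators of equal degree at two vertices are
nonnegatively correlated, so Var X ≥ n P(deg = d) P(deg = d') for any d' ≠ d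
(`card_mul_choose_mul_le_variance`).

With x = n^{1−α}, of the order of np, the distance is O(√(nx) / (n x^{d+d'})). The choice d' = 1 for
d = 0 and d' = 0 for d ≥ 1 gives the claimed rates. -/

/-! ### Random subsets: means, the Efron-Stein inequality, resampling -/

/-- The mean of `f S` for a random subset `S` of `E` that contains each point of `E` with
probability `p`, independently. -/
noncomputable def bernoulliMean {ι : Type*} (p : ℝ) (E : Finset ι) (f : Finset ι → ℝ) : ℝ :=
  ∑ S ∈ E.powerset, p ^ S.card * (1 - p) ^ (E.card - S.card) * f S

/-- The set that agrees with `T` on the block `B` and with `S` elsewhere. -/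
def resample {ι : Type*} [DecidableEq ι] (B S T : Finset ι) : Finset ι := (S \ B) ∪ (T ∩ B)

section Resample

variable {ι : Type*} [DecidableEq ι] {B S T : Finset ι}

theorem mem_resample {e : ι} : e ∈ resample B S T ↔ (e ∈ S ∧ e ∉ B) ∨ (e ∈ T ∧ e ∈ B) := by
  simp [resample]

theorem resample_resample : resample B (resample B S T) (resample B T S) = S := by
  ext e
  simp only [mem_resample]
  tauto

theorem resample_inter : resample B S T ∩ B = T ∩ B := by
  ext e
  simp only [Finset.mem_inter, mem_resample]
  tauto

theorem resample_inter_of_disjoint {A : Finset ι} (h : Disjoint A B) :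
    resample B S T ∩ A = S ∩ A := by
  ext e
  have : e ∈ A → e ∉ B := fun he => Finset.disjoint_left.1 h he
  simp only [Finset.mem_inter, mem_resample]
  tauto

theorem resample_subset {E : Finset ι} (hS : S ⊆ E) (hT : T ⊆ E) : resample B S T ⊆ E := by
  intro e he
  rcases mem_resample.1 he with h | h
  exacts [hS h.1, hT h.1]

theorem card_resample_add : (resample B S T).card + (resample B T S).card = S.card + T.card := by
  have h (S T : Finset ι) : (resample B S T).card = (S \ B).card + (T ∩ B).card :=
    Finset.card_union_of_disjoint (Finset.disjoint_left.2 fun e h1 h2 => by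
      simp only [Finset.mem_sdiff, Finset.mem_inter] at h1 h2
      exact h1.2 h2.2)
  have h2 := Finset.card_sdiff_add_card_inter S B
  have h3 := Finset.card_sdiff_add_card_inter T B
  rw [h, h]
  omega

end Resample

namespace bernoulliMean

variable {ι : Type*} {p : ℝ} {E : Finset ι} {f g : Finset ι → ℝ}

theorem congr (h : ∀ S ⊆ E, f S = g S) : bernoulliMean p E f = bernoulliMean p E g :=
  Finset.sum_congr rfl fun S hS => by rw [h S (Finset.mem_powerset.1 hS)]

theorem add : bernoulliMean p E (fun S => f S + g S) = bernoulliMean p E f + bernoulliMean p E g := by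
  simp only [bernoulliMean, mul_add, Finset.sum_add_distrib]

theorem sub : bernoulliMean p E (fun S => f S - g S) = bernoulliMean p E f - bernoulliMean p E g := by
  simp only [bernoulliMean, mul_sub, Finset.sum_sub_distrib]

theorem const_mul (c : ℝ) : bernoulliMean p E (fun S => c * f S) = c * bernoulliMean p E f := by
  simp only [bernoulliMean, Finset.mul_sum]
  exact Finset.sum_congr rfl fun S _ => by ring

theorem mul_const (c : ℝ) : bernoulliMean p E (fun S => f S * c) = bernoulliMean p E f * c := by
  rw [mul_comm, ← const_mul]
  exact congr fun S _ => mul_comm _ _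

theorem sum {κ : Type*} (s : Finset κ) (F : κ → Finset ι → ℝ) :
    bernoulliMean p E (fun S => ∑ k ∈ s, F k S) = ∑ k ∈ s, bernoulliMean p E (F k) := by
  simp only [bernoulliMean, Finset.mul_sum]
  exact Finset.sum_comm

theorem one : bernoulliMean p E (fun _ => 1) = 1 := by
  simp [bernoulliMean, Finset.sum_pow_mul_eq_add_pow]

theorem const (c : ℝ) : bernoulliMean p E (fun _ => c) = c := by
  simpa [one] using const_mul (p := p) (E := E) (f := fun _ => 1) c

theorem mono (h0 : 0 ≤ p) (h1 : p ≤ 1) (h : ∀ S ⊆ E, f S ≤ g S) :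
    bernoulliMean p E f ≤ bernoulliMean p E g :=
  Finset.sum_le_sum fun S hS => mul_le_mul_of_nonneg_left (h S (Finset.mem_powerset.1 hS))
    (mul_nonneg (pow_nonneg h0 _) (pow_nonneg (sub_nonneg.2 h1) _))

theorem nonneg (h0 : 0 ≤ p) (h1 : p ≤ 1) (h : ∀ S ⊆ E, 0 ≤ f S) : 0 ≤ bernoulliMean p E f := by
  simpa [const] using mono (f := fun _ => 0) h0 h1 h

theorem abs_le (h0 : 0 ≤ p) (h1 : p ≤ 1) :
    |bernoulliMean p E f| ≤ bernoulliMean p E (fun S => |f S|) := by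
  rw [_root_.abs_le]
  constructor
  · rw [neg_le_iff_add_nonneg, ← add]
    exact nonneg h0 h1 fun S _ => by linarith [neg_abs_le (f S)]
  · exact mono h0 h1 fun S _ => le_abs_self _

theorem sq_sub_mean : bernoulliMean p E (fun S => (f S - bernoulliMean p E f) ^ 2) =
    bernoulliMean p E (fun S => f S ^ 2) - bernoulliMean p E f ^ 2 := by
  set m := bernoulliMean p E f with hm
  rw [show (fun S => (f S - m) ^ 2) = fun S => (f S ^ 2 - 2 * m * f S) + m ^ 2 by ext; ring,
    add, sub, const_mul, const, ← hm]
  ring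

theorem sq_le (h0 : 0 ≤ p) (h1 : p ≤ 1) :
    bernoulliMean p E f ^ 2 ≤ bernoulliMean p E (fun S => f S ^ 2) := by
  rw [← sub_nonneg, ← sq_sub_mean]
  exact nonneg h0 h1 fun S _ => sq_nonneg _

theorem abs_le_sqrt (h0 : 0 ≤ p) (h1 : p ≤ 1) :
    bernoulliMean p E (fun S => |f S|) ≤ √(bernoulliMean p E (fun S => f S ^ 2)) := by
  apply Real.le_sqrt_of_sq_le
  simpa using sq_le (f := fun S => |f S|) (E := E) h0 h1

variable [DecidableEq ι]

theorem insert {e : ι} (he : e ∉ E) : bernoulliMean p (Insert.insert e E) f =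
    (1 - p) * bernoulliMean p E f + p * bernoulliMean p E (fun S => f (Insert.insert e S)) := by
  simp only [bernoulliMean, Finset.sum_powerset_insert he, Finset.mul_sum]
  congr 1
  · refine Finset.sum_congr rfl fun S hS => ?_
    have := Finset.card_le_card (Finset.mem_powerset.1 hS)
    rw [Finset.card_insert_of_notMem he, Nat.succ_sub this, pow_succ]
    ring
  · refine Finset.sum_congr rfl fun S hS => ?_
    rw [Finset.card_insert_of_notMem he,
      Finset.card_insert_of_notMem fun h => he (Finset.mem_powerset.1 hS h), Nat.add_sub_add_right,
      pow_succ]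
    ring

/-- The Efron-Stein inequality. -/
theorem variance_le (h0 : 0 ≤ p) (h1 : p ≤ 1) :
    bernoulliMean p E (fun S => f S ^ 2) - bernoulliMean p E f ^ 2 ≤
      p * (1 - p) * ∑ e ∈ E, bernoulliMean p E
        (fun S => (f (Insert.insert e S) - f (S.erase e)) ^ 2) := by
  induction E using Finset.induction_on generalizing f with
  | empty => simp [bernoulliMean]
  | insert a E ha ih =>
    have hq : 0 ≤ 1 - p := sub_nonneg.2 h1
    have hA := mul_le_mul_of_nonneg_left (ih (f := f)) hq
    have hB := mul_le_mul_of_nonneg_left (ih (f := fun S => f (Insert.insert a S))) h0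
    -- Conditioning on `a` splits the variance into the mean of two conditional variances, handled
    -- by induction, and `p * (1 - p)` times the squared difference of the conditional means.
    -- Jensen's inequality bounds the latter by the term of the sum at `a`.
    have hAB := mul_le_mul_of_nonneg_left (sq_le (E := E)
      (f := fun S => f S - f (Insert.insert a S)) h0 h1) (mul_nonneg h0 hq)
    rw [sub] at hAB
    have hE : ∑ e ∈ E, bernoulliMean p (Insert.insert a E)
          (fun S => (f (Insert.insert e S) - f (S.erase e)) ^ 2) =
        (1 - p) * ∑ e ∈ E, bernoulliMean p E
          (fun S => (f (Insert.insert e S) - f (S.erase e)) ^ 2) +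
        p * ∑ e ∈ E, bernoulliMean p E
          (fun S => (f (Insert.insert a (Insert.insert e S)) - f (Insert.insert a (S.erase e))) ^ 2) := by
      rw [Finset.mul_sum, Finset.mul_sum, ← Finset.sum_add_distrib]
      refine Finset.sum_congr rfl fun e he => ?_
      have hea : e ≠ a := fun h => ha (h ▸ he)
      rw [insert ha]
      congr 3
      ext S
      rw [Finset.insert_comm, Finset.erase_insert_of_ne hea.symm]
    have ha' : bernoulliMean p (Insert.insert a E)
          (fun S => (f (Insert.insert a S) - f (S.erase a)) ^ 2) =
        bernoulliMean p E (fun S => (f S - f (Insert.insert a S)) ^ 2) := by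
      have h3 : ∀ S ⊆ E, S.erase a = S := fun S hS => Finset.erase_eq_of_notMem fun h => ha (hS h)
      rw [insert ha, congr (g := fun S => (f S - f (Insert.insert a S)) ^ 2) fun S hS => by
        rw [h3 S hS]; ring, congr (f := fun S => (f (Insert.insert a (Insert.insert a S)) -
          f ((Insert.insert a S).erase a)) ^ 2) (g := fun S => (f S - f (Insert.insert a S)) ^ 2)
          fun S hS => by
            rw [Finset.insert_idem, Finset.erase_insert fun h => ha (hS h)]; ring]
      ring
    rw [Finset.sum_insert ha, hE, ha', insert ha, insert ha]
    nlinarith [hA, hB, hAB]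

/-- Exchanging the blocks is an involution on pairs, and it preserves `S.card + T.card`, hence the
joint weight. -/
theorem resample_swap (B : Finset ι) (F : Finset ι → Finset ι → ℝ) :
    bernoulliMean p E (fun S => bernoulliMean p E (fun T => F (resample B S T) (resample B T S))) =
      bernoulliMean p E (fun S => bernoulliMean p E (fun T => F S T)) := by
  simp only [bernoulliMean, Finset.mul_sum]
  rw [← Finset.sum_product', ← Finset.sum_product']
  refine Finset.sum_bij' (fun x _ => (resample B x.1 x.2, resample B x.2 x.1))
    (fun x _ => (resample B x.1 x.2, resample B x.2 x.1)) ?_ ?_ ?_ ?_ ?_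
  · rintro ⟨S, T⟩ h
    simp only [Finset.mem_product, Finset.mem_powerset] at h ⊢
    exact ⟨resample_subset h.1 h.2, resample_subset h.2 h.1⟩
  · rintro ⟨S, T⟩ h
    simp only [Finset.mem_product, Finset.mem_powerset] at h ⊢
    exact ⟨resample_subset h.1 h.2, resample_subset h.2 h.1⟩
  · rintro ⟨S, T⟩ h
    simp [resample_resample]
  · rintro ⟨S, T⟩ h
    simp [resample_resample]
  · rintro ⟨S, T⟩ h
    simp only [Finset.mem_product, Finset.mem_powerset] at h ⊢
    have h1 := Finset.card_le_card h.1
    have h2 := Finset.card_le_card h.2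
    have h3 := Finset.card_le_card (resample_subset (B := B) h.1 h.2)
    have h4 := Finset.card_le_card (resample_subset (B := B) h.2 h.1)
    have h5 := card_resample_add (B := B) (S := S) (T := T)
    rw [← mul_assoc (_ * _) (_ * _), ← mul_assoc (_ * _) (_ * _)]
    congr 1
    rw [mul_mul_mul_comm, ← pow_add, ← pow_add, mul_mul_mul_comm, ← pow_add, ← pow_add, h5]
    congr 2
    omega

/-- Independence from exchangeability: resampling `B` leaves `f S` alone and turns `g S` into `g T`.
-/
theorem mul_of_disjoint {A B : Finset ι} (hAB : Disjoint A B) (hf : ∀ S, f (S ∩ A) = f S)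
    (hg : ∀ S, g (S ∩ B) = g S) :
    bernoulliMean p E (fun S => f S * g S) = bernoulliMean p E f * bernoulliMean p E g := by
  have h := resample_swap (p := p) (E := E) B fun S T => f S * g T
  have h1 (S T : Finset ι) : f (resample B S T) = f S := by
    rw [← hf, resample_inter_of_disjoint hAB, hf]
  have h2 (S T : Finset ι) : g (resample B S T) = g T := by
    rw [← hg, resample_inter, hg]
  simp only [h1, h2, const, const_mul, mul_const] at h
  exact h

theorem of_subset {B : Finset ι} (hB : B ⊆ E) (hf : ∀ S, f (S ∩ B) = f S) :
    bernoulliMean p E f = bernoulliMean p B f := by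
  rw [← Finset.union_sdiff_of_subset hB]
  generalize hC : E \ B = C
  have hd : Disjoint B C := hC ▸ Finset.disjoint_sdiff
  clear hC
  induction C using Finset.induction_on with
  | empty => simp
  | insert a C ha ih =>
    rw [Finset.disjoint_insert_right] at hd
    have h (S : Finset ι) : f (Insert.insert a S) = f S := by
      rw [← hf, Finset.insert_inter_of_notMem hd.1, hf]
    simp only [Finset.union_insert, insert (show a ∉ B ∪ C by simp [ha, hd.1]), h, ih hd.2]
    ring

theorem mem {e : ι} (he : e ∈ E) : bernoulliMean p E (fun S => if e ∈ S then 1 else 0) = p := by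
  rw [of_subset (B := {e}) (by simpa using he) (by simp)]
  rw [← insert_empty_eq, insert (Finset.notMem_empty e)]
  simp [bernoulliMean]

end bernoulliMean

/-! ### Gaussian tail estimates -/

/-- The distribution function of the standard normal law. -/
noncomputable def gaussianCDF (x : ℝ) : ℝ := (gaussianReal 0 1).real (Set.Iic x)

/-- The density of the standard normal law. -/
noncomputable def gaussianDensity (x : ℝ) : ℝ := gaussianPDFReal 0 1 x

theorem gaussianDensity_eq (x : ℝ) :
    gaussianDensity x = (√(2 * Real.pi))⁻¹ * Real.exp (-x ^ 2 / 2) := by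
  simp [gaussianDensity, gaussianPDFReal]

theorem gaussianDensity_pos (x : ℝ) : 0 < gaussianDensity x :=
  gaussianPDFReal_pos 0 1 x one_ne_zero

theorem gaussianDensity_neg (x : ℝ) : gaussianDensity (-x) = gaussianDensity x := by
  simp [gaussianDensity_eq]

theorem hasDerivAt_gaussianDensity (x : ℝ) :
    HasDerivAt gaussianDensity (-x * gaussianDensity x) x := by
  have h : HasDerivAt (fun x : ℝ => -x ^ 2 / 2) (-x) x :=
    (((hasDerivAt_id x).pow 2).neg.div_const 2).congr_deriv (by simp; ring)
  rw [funext gaussianDensity_eq]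
  exact (h.exp.const_mul _).congr_deriv (by ring)

theorem tendsto_gaussianDensity_atBot : Tendsto gaussianDensity atBot (𝓝 0) := by
  rw [funext gaussianDensity_eq, ← mul_zero (√(2 * Real.pi))⁻¹]
  refine (Real.tendsto_exp_atBot.comp ?_).const_mul _
  have h : Tendsto (fun x : ℝ => x ^ 2) atBot atTop := by
    simpa [Function.comp_def] using
      (tendsto_pow_atTop (α := ℝ) two_ne_zero).comp tendsto_abs_atBot_atTop
  have := (tendsto_neg_atTop_atBot.comp h).atBot_div_const (zero_lt_two' ℝ)
  simpa using this

theorem gaussianCDF_nonneg (x : ℝ) : 0 ≤ gaussianCDF x := measureReal_nonneg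

theorem gaussianCDF_le_one (x : ℝ) : gaussianCDF x ≤ 1 := measureReal_le_one

theorem gaussianCDF_mono : Monotone gaussianCDF := fun _ _ h =>
  measureReal_mono (Set.Iic_subset_Iic.2 h)

theorem tendsto_gaussianCDF_atBot : Tendsto gaussianCDF atBot (𝓝 0) := by
  have := tendsto_cdf_atBot (gaussianReal 0 1)
  rwa [show (cdf (gaussianReal 0 1) : ℝ → ℝ) = gaussianCDF from
    funext fun x => cdf_eq_real _ x] at this

theorem gaussianCDF_neg (x : ℝ) : gaussianCDF (-x) = 1 - gaussianCDF x := by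
  have h1 : (gaussianReal 0 1).map (fun x => -x) = gaussianReal 0 1 := by
    rw [gaussianReal_map_neg, neg_zero]
  have : NullSingletonClass (gaussianReal 0 1) := nullSingletonClass_gaussianReal one_ne_zero
  have h2 : (gaussianReal 0 1).real (Set.Iic x)ᶜ = 1 - gaussianCDF x :=
    probReal_compl_eq_one_sub measurableSet_Iic
  rw [← h2, gaussianCDF, ← h1, map_measureReal_apply measurable_neg measurableSet_Iic, h1,
    Set.compl_Iic, show (fun x : ℝ => -x) ⁻¹' Set.Iic (-x) = Set.Ici x by ext; simp]
  exact measureReal_congr Ioi_ae_eq_Ici.symm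

theorem hasDerivAt_gaussianCDF (x : ℝ) : HasDerivAt gaussianCDF (gaussianDensity x) x := by
  have hi : Integrable gaussianDensity := integrable_gaussianPDFReal 0 1
  have hc : Continuous gaussianDensity :=
    continuous_iff_continuousAt.2 fun x => (hasDerivAt_gaussianDensity x).continuousAt
  have h (x : ℝ) : gaussianCDF x = gaussianCDF 0 + ∫ t in (0 : ℝ)..x, gaussianDensity t := by
    have h1 (x : ℝ) : gaussianCDF x = ∫ t in Set.Iic x, gaussianDensity t := by
      rw [gaussianCDF, measureReal_def, gaussianReal_apply_eq_integral 0 one_ne_zero,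
        ENNReal.toReal_ofReal (integral_nonneg (gaussianPDFReal_nonneg 0 1))]
      rfl
    rw [h1, h1, intervalIntegral.integral_Iic_sub_Iic hi.integrableOn hi.integrableOn |>.symm]
    ring
  rw [funext h]
  exact (intervalIntegral.integral_hasDerivAt_right (hc.intervalIntegrable _ _)
    (hc.stronglyMeasurableAtFilter _ _) hc.continuousAt).const_add _

/-- Lower Mills ratio bound: `ψ` vanishes at `-∞` and has positive derivative. It is what makes `x *
Φ x / φ x` monotone. -/
theorem gaussianDensity_mul_le (x : ℝ) :
    -x * gaussianDensity x ≤ (1 + x ^ 2) * gaussianCDF x := by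
  set ψ : ℝ → ℝ := fun x => gaussianCDF x + x / (1 + x ^ 2) * gaussianDensity x with hψ
  have hpos (x : ℝ) : 0 < 1 + x ^ 2 := by positivity
  have hd (x : ℝ) : HasDerivAt ψ (2 / (1 + x ^ 2) ^ 2 * gaussianDensity x) x := by
    have h1 : HasDerivAt (fun x : ℝ => x / (1 + x ^ 2)) ((1 - x ^ 2) / (1 + x ^ 2) ^ 2) x :=
      ((hasDerivAt_id x).div (((hasDerivAt_id x).pow 2).const_add 1) (hpos x).ne').congr_deriv
        (by simp; ring)
    refine ((hasDerivAt_gaussianCDF x).add (h1.mul (hasDerivAt_gaussianDensity x))).congr_deriv ?_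
    have := (hpos x).ne'
    field_simp
    ring
  have hmono : Monotone ψ := monotone_of_deriv_nonneg (fun x => (hd x).differentiableAt) fun x => by
    rw [(hd x).deriv]
    have := gaussianDensity_pos x
    positivity
  have hlim : Tendsto ψ atBot (𝓝 0) := by
    rw [← add_zero (0 : ℝ)]
    refine tendsto_gaussianCDF_atBot.add (squeeze_zero_norm (fun x => ?_)
      tendsto_gaussianDensity_atBot)
    rw [norm_mul, Real.norm_of_nonneg (gaussianDensity_pos x).le, Real.norm_eq_abs, abs_div,
      abs_of_pos (hpos x)]
    refine mul_le_of_le_one_left (gaussianDensity_pos x).le ?_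
    rw [div_le_one (hpos x)]
    nlinarith [sq_abs x, sq_nonneg (|x| - 1)]
  have h0 : 0 ≤ ψ x := hmono.le_of_tendsto hlim x
  have h1 : (1 + x ^ 2) * ψ x = (1 + x ^ 2) * gaussianCDF x + x * gaussianDensity x := by
    have := (hpos x).ne'
    simp only [hψ]
    field_simp
  nlinarith [mul_nonneg (hpos x).le h0]

/-- Upper Mills ratio bound: `χ` vanishes at `-∞` and decreases on the negative axis, so it is
nonpositive there. -/
theorem neg_mul_gaussianCDF_le {x : ℝ} (hx : x ≤ 0) :
    -x * gaussianCDF x ≤ gaussianDensity x := by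
  set ψ : ℝ → ℝ := fun x => x * gaussianCDF x + gaussianDensity x with hψ
  set χ : ℝ → ℝ := fun x => gaussianCDF x + x⁻¹ * gaussianDensity x with hχ
  rcases hx.eq_or_lt with rfl | hx
  · simpa using (gaussianDensity_pos 0).le
  have hd {y : ℝ} (hy : y < 0) : HasDerivAt χ (-(y ^ 2)⁻¹ * gaussianDensity y) y :=
    ((hasDerivAt_gaussianCDF y).add ((hasDerivAt_inv hy.ne).mul
      (hasDerivAt_gaussianDensity y))).congr_deriv (by have := hy.ne; field_simp; ring)
  have hanti : AntitoneOn χ (Set.Iio 0) := by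
    refine antitoneOn_of_deriv_nonpos (convex_Iio 0)
      (fun y hy => (hd hy).continuousAt.continuousWithinAt) (fun y hy => ?_) fun y hy => ?_
    · rw [interior_Iio] at hy
      exact (hd hy).differentiableAt.differentiableWithinAt
    · rw [interior_Iio] at hy
      rw [(hd hy).deriv, neg_mul]
      have := gaussianDensity_pos y
      exact neg_nonpos.2 (by positivity)
  have hlim : Tendsto χ atBot (𝓝 0) := by
    have := tendsto_gaussianCDF_atBot.add (tendsto_inv_atBot_zero.mul tendsto_gaussianDensity_atBot)
    simpa using this
  have h0 : χ x ≤ 0 := ge_of_tendsto hlim <| (eventually_le_atBot x).mono fun y hy =>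
    hanti (Set.mem_Iio.2 (hy.trans_lt hx)) (Set.mem_Iio.2 hx) hy
  have h1 : x * χ x = x * gaussianCDF x + gaussianDensity x := by
    have := hx.ne
    simp only [hχ]
    field_simp
  nlinarith [mul_nonneg_of_nonpos_of_nonpos hx.le h0]

theorem mul_one_sub_gaussianCDF_le {x : ℝ} (hx : 0 ≤ x) :
    x * (1 - gaussianCDF x) ≤ gaussianDensity x := by
  simpa [gaussianCDF_neg, gaussianDensity_neg] using neg_mul_gaussianCDF_le (neg_nonpos.2 hx)

theorem hasDerivAt_gaussianCDF_div (x : ℝ) :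
    HasDerivAt (fun x => gaussianCDF x / gaussianDensity x)
      (1 + x * (gaussianCDF x / gaussianDensity x)) x := by
  have h := (gaussianDensity_pos x).ne'
  refine ((hasDerivAt_gaussianCDF x).div (hasDerivAt_gaussianDensity x) h).congr_deriv ?_
  field_simp
  ring

theorem monotone_mul_gaussianCDF_div :
    Monotone fun x => x * (gaussianCDF x / gaussianDensity x) := by
  have hd (x : ℝ) : HasDerivAt (fun x => x * (gaussianCDF x / gaussianDensity x)) _ x :=
    (hasDerivAt_id x).mul (hasDerivAt_gaussianCDF_div x)
  refine monotone_of_deriv_nonneg (fun x => (hd x).differentiableAt) fun x => ?_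
  rw [(hd x).deriv]
  have h := gaussianDensity_pos x
  have h1 : 0 ≤ ((1 + x ^ 2) * gaussianCDF x - -x * gaussianDensity x) / gaussianDensity x :=
    div_nonneg (sub_nonneg.2 (gaussianDensity_mul_le x)) h.le
  convert h1 using 1
  simp only [id]
  field_simp
  ring

/-! ### The solution of Stein's equation -/

/-- The bounded solution of Stein's equation `f' w - w * f w = 1_{w ≤ z} - Φ z`. -/
noncomputable def steinSolution (z w : ℝ) : ℝ :=
  if w ≤ z then (1 - gaussianCDF z) * (gaussianCDF w / gaussianDensity w)
  else gaussianCDF z * (gaussianCDF (-w) / gaussianDensity (-w))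

theorem steinSolution_of_le {z w : ℝ} (h : w ≤ z) :
    steinSolution z w = (1 - gaussianCDF z) * (gaussianCDF w / gaussianDensity w) := if_pos h

theorem steinSolution_of_ge {z w : ℝ} (h : z ≤ w) :
    steinSolution z w = gaussianCDF z * (gaussianCDF (-w) / gaussianDensity (-w)) := by
  rcases h.eq_or_lt with rfl | h
  · rw [steinSolution_of_le le_rfl, gaussianCDF_neg, gaussianDensity_neg]
    ring
  · exact if_neg h.not_ge

/-- With `h y = y * Φ y / φ y` nondecreasing, the function is `(1 - Φ z) * h w` up to `z` and `-Φ z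
* h (-w)` from there on. -/
theorem monotone_mul_steinSolution (z : ℝ) : Monotone fun w => w * steinSolution z w := by
  rw [← monotoneOn_univ, ← Set.Iic_union_Ici (a := z)]
  refine MonotoneOn.union_right (c := z) ?_ ?_ isGreatest_Iic isLeast_Ici
  · intro a ha b hb hab
    have := mul_le_mul_of_nonneg_left (monotone_mul_gaussianCDF_div hab)
      (sub_nonneg.2 (gaussianCDF_le_one z))
    simp only [steinSolution_of_le (Set.mem_Iic.1 ha), steinSolution_of_le (Set.mem_Iic.1 hb)]
    linarith
  · intro a ha b hb hab
    have := mul_le_mul_of_nonneg_left (monotone_mul_gaussianCDF_div (neg_le_neg hab))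
      (gaussianCDF_nonneg z)
    simp only [steinSolution_of_ge (Set.mem_Ici.1 ha), steinSolution_of_ge (Set.mem_Ici.1 hb)]
    linarith

/-- The product of the solution with the density is `Φ (min w z) * (1 - Φ (max w z))`, which is at
most both `Φ w` and `1 - Φ w`; the upper Mills ratio bound applies on either side of 0. -/
theorem abs_mul_steinSolution_le (z w : ℝ) : |w * steinSolution z w| ≤ 1 := by
  have hw := gaussianDensity_pos w
  have h1 := gaussianCDF_nonneg w
  have h2 := gaussianCDF_le_one w
  have h3 := gaussianCDF_nonneg z
  have h4 := gaussianCDF_le_one z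
  suffices |w * (steinSolution z w * gaussianDensity w)| ≤ gaussianDensity w by
    rwa [← mul_assoc, abs_mul, abs_of_pos hw, mul_le_iff_le_one_left hw] at this
  have key {a b : ℝ} (ha : 0 ≤ a) (hb : 0 ≤ b) (h : steinSolution z w * gaussianDensity w = a * b)
      (h5 : (a ≤ 1 ∧ b ≤ gaussianCDF w) ∨ (b ≤ 1 ∧ a ≤ gaussianCDF w))
      (h6 : (a ≤ 1 ∧ b ≤ 1 - gaussianCDF w) ∨ (b ≤ 1 ∧ a ≤ 1 - gaussianCDF w)) :
      |w * (steinSolution z w * gaussianDensity w)| ≤ gaussianDensity w := by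
    have h7 : a * b ≤ gaussianCDF w := by rcases h5 with h | h <;> nlinarith
    have h8 : a * b ≤ 1 - gaussianCDF w := by rcases h6 with h | h <;> nlinarith
    rw [h, abs_mul, abs_of_nonneg (mul_nonneg ha hb)]
    rcases le_total w 0 with hw0 | hw0
    · rw [abs_of_nonpos hw0]
      exact (mul_le_mul_of_nonneg_left h7 (neg_nonneg.2 hw0)).trans (neg_mul_gaussianCDF_le hw0)
    · rw [abs_of_nonneg hw0]
      exact (mul_le_mul_of_nonneg_left h8 hw0).trans (mul_one_sub_gaussianCDF_le hw0)
  rcases le_total w z with h | h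
  · have hm := gaussianCDF_mono h
    refine key (a := 1 - gaussianCDF z) (b := gaussianCDF w) (by linarith) h1 ?_
      (Or.inl ⟨by linarith, le_rfl⟩) (Or.inr ⟨h2, by linarith⟩)
    rw [steinSolution_of_le h]
    field_simp
  · have hm := gaussianCDF_mono h
    refine key (a := gaussianCDF z) (b := 1 - gaussianCDF w) h3 (by linarith) ?_
      (Or.inr ⟨by linarith, hm⟩) (Or.inl ⟨h4, le_rfl⟩)
    rw [steinSolution_of_ge h, gaussianCDF_neg, gaussianDensity_neg]
    field_simp

/-- The solution has a kink at `z`. The right derivative exists everywhere and suffices for the mean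
value inequality. -/
theorem hasDerivWithinAt_steinSolution (z x : ℝ) :
    HasDerivWithinAt (steinSolution z)
      (x * steinSolution z x - (if z ≤ x then 1 else 0) + (1 - gaussianCDF z)) (Set.Ici x) x := by
  rcases lt_or_ge x z with h | h
  · rw [if_neg h.not_ge, steinSolution_of_le h.le]
    refine HasDerivAt.hasDerivWithinAt ?_
    refine (((hasDerivAt_gaussianCDF_div x).const_mul (1 - gaussianCDF z)).congr_of_eventuallyEq
      ((eventually_le_nhds h).mono fun y hy => steinSolution_of_le hy)).congr_deriv (by ring)
  · rw [if_pos h, steinSolution_of_ge h]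
    have h1 := ((hasDerivAt_gaussianCDF_div (-x)).comp x (hasDerivAt_neg x)).const_mul
      (gaussianCDF z)
    refine (h1.hasDerivWithinAt.congr (fun y hy => steinSolution_of_ge (h.trans hy))
      (steinSolution_of_ge h)).congr_deriv (by ring)

theorem continuous_steinSolution (z : ℝ) : Continuous (steinSolution z) := by
  have hc : Continuous fun x => gaussianCDF x / gaussianDensity x :=
    continuous_iff_continuousAt.2 fun x => (hasDerivAt_gaussianCDF_div x).continuousAt
  refine Continuous.if_le (hc.const_mul _) ((hc.comp continuous_neg).const_mul _) continuous_id
    continuous_const fun w hw => ?_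
  subst hw
  exact (steinSolution_of_le le_rfl).symm.trans (steinSolution_of_ge le_rfl)

theorem steinSolution_sub_le {z a b : ℝ} (hab : a ≤ b) :
    steinSolution z b - steinSolution z a ≤ (b - a) *
      (b * steinSolution z b - (if a ≤ z then 0 else 1) + (1 - gaussianCDF z)) := by
  set C := b * steinSolution z b - (if a ≤ z then 0 else 1) + (1 - gaussianCDF z)
  have := image_le_of_deriv_right_le_deriv_boundary (f := steinSolution z) (a := a) (b := b)
    (B := fun x => steinSolution z a + C * (x - a)) (B' := fun _ => C)
    (continuous_steinSolution z).continuousOn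
    (fun x _ => hasDerivWithinAt_steinSolution z x) (by simp) (by fun_prop)
    (fun x _ => ((((hasDerivAt_id x).sub_const a).const_mul C).const_add _).hasDerivWithinAt.congr_deriv
      (by simp)) (fun x hx => ?_) (Set.right_mem_Icc.2 hab)
  · linarith
  · have h1 := monotone_mul_steinSolution z hx.2.le
    have h2 : (if a ≤ z then (0 : ℝ) else 1) ≤ if z ≤ x then 1 else 0 := by
      have := hx.1
      split_ifs <;> linarith
    simp only [C]
    linarith

theorem le_steinSolution_sub {z a b : ℝ} (hab : a ≤ b) :
    (b - a) * (a * steinSolution z a - (if b ≤ z then 0 else 1) + (1 - gaussianCDF z)) ≤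
      steinSolution z b - steinSolution z a := by
  set C := a * steinSolution z a - (if b ≤ z then 0 else 1) + (1 - gaussianCDF z)
  have := image_le_of_deriv_right_le_deriv_boundary (f := fun x => steinSolution z a + C * (x - a))
    (a := a) (b := b) (f' := fun _ => C) (B := steinSolution z) (by fun_prop)
    (fun x _ => ((((hasDerivAt_id x).sub_const a).const_mul C).const_add _).hasDerivWithinAt.congr_deriv
      (by simp)) (by simp) (continuous_steinSolution z).continuousOn
    (fun x _ => hasDerivWithinAt_steinSolution z x) (fun x hx => ?_) (Set.right_mem_Icc.2 hab)
  · linarith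
  · have h1 := monotone_mul_steinSolution z hx.1
    have h2 : (if z ≤ x then (1 : ℝ) else 0) ≤ if b ≤ z then 0 else 1 := by
      have := hx.2
      split_ifs <;> linarith
    simp only [C]
    linarith

/-- The increment of Stein's solution is the increment of the argument times the derivative, up
to an error that is antisymmetric in the two points. -/
theorem abs_steinSolution_sub_sub_le (z a b : ℝ) :
    |steinSolution z a - steinSolution z b - (a - b) *
      (a * steinSolution z a + (if a ≤ z then 1 else 0) - gaussianCDF z)| ≤
      (a - b) * ((a * steinSolution z a - if a ≤ z then 1 else 0) -
        (b * steinSolution z b - if b ≤ z then 1 else 0)) := by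
  have hn (w : ℝ) : (if w ≤ z then (0 : ℝ) else 1) = 1 - if w ≤ z then 1 else 0 := by
    split_ifs <;> norm_num
  have hm {a b : ℝ} (h : a ≤ b) : (if b ≤ z then (1 : ℝ) else 0) ≤ if a ≤ z then 1 else 0 := by
    split_ifs <;> linarith
  -- The derivative is the nondecreasing `w * f w` plus the nonincreasing indicator, up to a
  -- constant. Between the two points it deviates from its value at `a` by at most the sum of the
  -- absolute increments of these two parts.
  rcases le_total a b with h | h
  · have h1 := steinSolution_sub_le (z := z) h
    have h2 := le_steinSolution_sub (z := z) h
    have h3 := mul_nonneg (sub_nonneg.2 h) (sub_nonneg.2 (hm h))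
    have h4 := mul_nonneg (sub_nonneg.2 h) (sub_nonneg.2 (monotone_mul_steinSolution z h))
    rw [hn] at h1 h2
    rw [abs_le]
    constructor <;> nlinarith
  · have h1 := steinSolution_sub_le (z := z) h
    have h2 := le_steinSolution_sub (z := z) h
    have h3 := mul_nonneg (sub_nonneg.2 h) (sub_nonneg.2 (hm h))
    have h4 := mul_nonneg (sub_nonneg.2 h) (sub_nonneg.2 (monotone_mul_steinSolution z h))
    rw [hn] at h1 h2
    rw [abs_le]
    constructor <;> nlinarith

/-! ### Block resampling and the Berry-Esseen bound -/

/-- The mean, over independent copies `T` of `S`, of the change of `X` when the block `B v` of `S`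
is replaced with that of `T`, with weights `Φ v S T`, summed over `v`. -/
noncomputable def resamplingSum {ι κ : Type*} [DecidableEq ι] [Fintype κ] (p : ℝ) (E : Finset ι)
    (B : κ → Finset ι) (Φ : κ → Finset ι → Finset ι → ℝ) (X : Finset ι → ℝ) (S : Finset ι) : ℝ :=
  ∑ v, bernoulliMean p E fun T => Φ v S T * (X S - X (resample (B v) S T))

section SteinMethod

open bernoulliMean

variable {ι κ : Type*} [DecidableEq ι] [Fintype κ] {p : ℝ} {E : Finset ι} {B : κ → Finset ι}
  {I : κ → Finset ι → ℝ} {X : Finset ι → ℝ}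

theorem apply_resample_of_inter {f : Finset ι → ℝ} {A : Finset ι} (hf : ∀ S, f (S ∩ A) = f S)
    (S T : Finset ι) : f (resample A S T) = f T := by
  rw [← hf, resample_inter, hf]

/-- Of the four products, `f T * g (resample A S T)` has the mean of `f S * g S`. Both mixed
products have that of `f T * g S`, where the two factors are independent. -/
theorem bernoulliMean_sub_mul_sub_resample {f : Finset ι → ℝ} {A : Finset ι}
    (hf : ∀ S, f (S ∩ A) = f S) (g : Finset ι → ℝ) :
    bernoulliMean p E (fun S => bernoulliMean p E fun T =>
      (f S - f T) * (g S - g (resample A S T))) =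
    2 * (bernoulliMean p E (fun S => f S * g S) - bernoulliMean p E f * bernoulliMean p E g) := by
  have h1 := resample_swap (p := p) (E := E) A fun S T => f S * g S
  have h2 := resample_swap (p := p) (E := E) A fun S T => f T * g S
  simp only [apply_resample_of_inter hf, const, mul_const] at h1 h2
  have h3 : bernoulliMean p E (fun S => bernoulliMean p E fun T =>
      (f S - f T) * (g S - g (resample A S T))) =
      bernoulliMean p E (fun S => bernoulliMean p E fun T =>
        (f S * g S + f T * g (resample A S T)) - (f T * g S + f S * g (resample A S T))) :=
    congr fun S _ => congr fun T _ => by ring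
  simp only [add, sub] at h3
  rw [h3, h1, h2]
  simp only [const, const_mul, mul_const]
  ring

/-- The weight is symmetric and the increment of `X` antisymmetric under the exchange of blocks, so
the two halves of the difference of `k` contribute equally. With `k = 1` this shows that the sum
with absolute weights has mean zero. -/
theorem bernoulliMean_abs_mul_sub_resample {f : Finset ι → ℝ} {A : Finset ι}
    (hf : ∀ S, f (S ∩ A) = f S) (X k : Finset ι → ℝ) :
    bernoulliMean p E (fun S => bernoulliMean p E fun T =>
      |f S - f T| * (X S - X (resample A S T)) * (k S - k (resample A S T))) =
    2 * bernoulliMean p E (fun S => k S * bernoulliMean p E fun T =>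
      |f S - f T| * (X S - X (resample A S T))) := by
  have h1 := resample_swap (p := p) (E := E) A fun S T =>
    |f S - f T| * (X S - X (resample A S T)) * k S
  simp only [apply_resample_of_inter hf, resample_resample] at h1
  have h2 : bernoulliMean p E (fun S => bernoulliMean p E fun T =>
      |f S - f T| * (X S - X (resample A S T)) * (k S - k (resample A S T))) =
      bernoulliMean p E (fun S => bernoulliMean p E fun T =>
        |f S - f T| * (X S - X (resample A S T)) * k S +
          |f T - f S| * (X (resample A S T) - X S) * k (resample A S T)) :=
    congr fun S _ => congr fun T _ => by rw [abs_sub_comm (f T)]; ring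
  simp only [add] at h2
  rw [h2, h1, ← two_mul]
  congr 1
  exact congr fun S _ => by rw [mul_const, mul_comm]

theorem bernoulliMean_sub_mul (hI : ∀ v S, I v (S ∩ B v) = I v S) (hX : ∀ S, X S = ∑ v, I v S)
    (g : Finset ι → ℝ) :
    bernoulliMean p E (fun S => (X S - bernoulliMean p E X) * g S) =
      2⁻¹ * bernoulliMean p E (fun S => ∑ v, bernoulliMean p E fun T =>
        (I v S - I v T) * (g S - g (resample (B v) S T))) := by
  rw [sum, Finset.sum_congr rfl fun v _ => bernoulliMean_sub_mul_sub_resample (hI v) g,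
    ← Finset.mul_sum, Finset.sum_sub_distrib, ← Finset.sum_mul, ← sum, ← sum]
  simp only [← Finset.sum_mul, ← hX, sub_mul, sub, const_mul]
  ring

theorem bernoulliMean_resamplingSum_sub (hI : ∀ v S, I v (S ∩ B v) = I v S)
    (hX : ∀ S, X S = ∑ v, I v S) :
    bernoulliMean p E (resamplingSum p E B (fun v S T => I v S - I v T) X) =
      2 * bernoulliMean p E (fun S => (X S - bernoulliMean p E X) ^ 2) := by
  have h := bernoulliMean_sub_mul (p := p) (E := E) hI hX X
  have h1 : bernoulliMean p E (fun S => (X S - bernoulliMean p E X) * X S) =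
      bernoulliMean p E (fun S => (X S - bernoulliMean p E X) ^ 2) := by
    rw [sq_sub_mean]
    simp only [sub_mul, sub, const_mul]
    simp only [sq]
  rw [← h1, h]
  exact (mul_inv_cancel_left₀ two_ne_zero _).symm

theorem bernoulliMean_resamplingSum_abs_sub (hI : ∀ v S, I v (S ∩ B v) = I v S) :
    bernoulliMean p E (resamplingSum p E B (fun v S T => |I v S - I v T|) X) = 0 := by
  unfold resamplingSum
  rw [sum]
  refine Finset.sum_eq_zero fun v _ => ?_
  have h := bernoulliMean_abs_mul_sub_resample (p := p) (E := E) (hI v) X fun _ => 1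
  simpa [const, eq_comm] using h

theorem abs_bernoulliMean_sub_gaussianCDF_le (h0 : 0 ≤ p) (h1 : p ≤ 1)
    (hI : ∀ v S, I v (S ∩ B v) = I v S) (hX : ∀ S, X S = ∑ v, I v S) {s : ℝ} (hs : 0 < s) (z : ℝ) :
    |bernoulliMean p E (fun S => if (X S - bernoulliMean p E X) / s ≤ z then 1 else 0) -
        gaussianCDF z| ≤
      2 * bernoulliMean p E (fun S =>
        |1 - resamplingSum p E B (fun v S T => I v S - I v T) X S / (2 * s ^ 2)|) +
      2 / s ^ 2 * bernoulliMean p E (fun S =>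
        |resamplingSum p E B (fun v S T => |I v S - I v T|) X S|) := by
  set m := bernoulliMean p E X with hm
  set W : Finset ι → ℝ := fun S => (X S - m) / s with hW
  set f := steinSolution z
  set J : ℝ → ℝ := fun w => if w ≤ z then 1 else 0 with hJ
  set Y := resamplingSum p E B (fun v S T => I v S - I v T) X with hY
  set R := resamplingSum p E B (fun v S T => |I v S - I v T|) X with hR
  have hJ0 (w : ℝ) : 0 ≤ J w ∧ J w ≤ 1 := by
    simp only [hJ]
    split_ifs <;> norm_num
  have hf (w : ℝ) := abs_le.1 (abs_mul_steinSolution_le z w)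
  have hW' (S T : Finset ι) : W S - W T = s⁻¹ * (X S - X T) := by
    simp only [hW]
    field_simp
    ring
  -- The derivative of Stein's solution at `W S`, with the convention `w ≤ z` at the kink.
  set G : Finset ι → ℝ := fun S => W S * f (W S) + J (W S) - gaussianCDF z with hG
  have hst := bernoulliMean_sub_mul (p := p) (E := E) hI hX fun S => f (W S)
  have herr : |bernoulliMean p E (fun S => W S * f (W S)) -
      bernoulliMean p E (fun S => G S * (Y S / (2 * s ^ 2)))| ≤
      2 / s ^ 2 * bernoulliMean p E (fun S => |R S|) := by
    have e1 : bernoulliMean p E (fun S => W S * f (W S)) = (2 * s)⁻¹ *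
        bernoulliMean p E (fun S => ∑ v, bernoulliMean p E fun T =>
          (I v S - I v T) * (f (W S) - f (W (resample (B v) S T)))) := by
      rw [mul_inv, mul_comm 2⁻¹, mul_assoc, ← hst, ← const_mul]
      exact congr fun S _ => by simp only [hW]; ring
    have e2 : bernoulliMean p E (fun S => G S * (Y S / (2 * s ^ 2))) = (2 * s)⁻¹ *
        bernoulliMean p E (fun S => ∑ v, bernoulliMean p E fun T =>
          (I v S - I v T) * ((W S - W (resample (B v) S T)) * G S)) := by
      rw [← const_mul]
      refine congr fun S _ => ?_
      simp only [hY, resamplingSum, Finset.sum_div, Finset.mul_sum]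
      refine Finset.sum_congr rfl fun v _ => ?_
      simp only [hW']
      rw [← const_mul, div_eq_mul_inv, ← mul_const, ← const_mul]
      exact congr fun T _ => by field_simp
    -- The bound for the Taylor error is symmetric in the two points, so exchangeability collapses
    -- its weighted mean to `(W f(W) - J(W)) * R`.
    have e3 : bernoulliMean p E (fun S => (W S * f (W S) - J (W S)) * R S) = s / 2 *
        bernoulliMean p E (fun S => ∑ v, bernoulliMean p E fun T =>
          |I v S - I v T| * ((W S - W (resample (B v) S T)) *
            ((W S * f (W S) - J (W S)) - (W (resample (B v) S T) * f (W (resample (B v) S T)) -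
              J (W (resample (B v) S T)))))) := by
      simp only [hR, resamplingSum, Finset.mul_sum, sum]
      refine Finset.sum_congr rfl fun v _ => ?_
      have := bernoulliMean_abs_mul_sub_resample (p := p) (E := E) (hI v) X
        (fun S => W S * f (W S) - J (W S))
      rw [eq_comm, ← mul_right_inj' (two_ne_zero' ℝ), ← this, ← mul_assoc, ← const_mul]
      refine congr fun S _ => ?_
      rw [← const_mul]
      exact congr fun T _ => by
        rw [hW']
        field_simp
    have hle : |bernoulliMean p E (fun S => W S * f (W S)) -
        bernoulliMean p E (fun S => G S * (Y S / (2 * s ^ 2)))| ≤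
        (2 * s)⁻¹ * (2 / s *
          bernoulliMean p E (fun S => (W S * f (W S) - J (W S)) * R S)) := by
      have : 2 / s * (s / 2) = 1 := by field_simp
      rw [e3, ← mul_assoc (2 / s), this, one_mul, e1, e2, ← mul_sub, abs_mul,
        abs_of_pos (by positivity : 0 < (2 * s)⁻¹), ← sub]
      refine mul_le_mul_of_nonneg_left ((abs_le h0 h1).trans (mono h0 h1 fun S _ => ?_))
        (by positivity)
      rw [← Finset.sum_sub_distrib]
      refine (Finset.abs_sum_le_sum_abs _ _).trans (Finset.sum_le_sum fun v _ => ?_)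
      rw [← sub]
      refine (abs_le h0 h1).trans (mono h0 h1 fun T _ => ?_)
      rw [← mul_sub, abs_mul]
      exact mul_le_mul_of_nonneg_left (abs_steinSolution_sub_sub_le z _ _) (abs_nonneg _)
    have hk : bernoulliMean p E (fun S => (W S * f (W S) - J (W S)) * R S) ≤
        2 * bernoulliMean p E (fun S => |R S|) := by
      rw [← const_mul]
      refine mono h0 h1 fun S _ => (le_abs_self _).trans ?_
      rw [abs_mul]
      refine mul_le_mul_of_nonneg_right (_root_.abs_le.2 ?_) (abs_nonneg _)
      constructor <;> linarith [hJ0 (W S), hf (W S)]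
    calc _ ≤ _ := hle
      _ = (s ^ 2)⁻¹ * bernoulliMean p E (fun S => (W S * f (W S) - J (W S)) * R S) := by
        field_simp
      _ ≤ (s ^ 2)⁻¹ * (2 * bernoulliMean p E (fun S => |R S|)) :=
        mul_le_mul_of_nonneg_left hk (by positivity)
      _ = _ := by ring
  have hmain : bernoulliMean p E (fun S => if W S ≤ z then 1 else 0) - gaussianCDF z =
      bernoulliMean p E (fun S => G S * (1 - Y S / (2 * s ^ 2))) -
      (bernoulliMean p E (fun S => W S * f (W S)) -
        bernoulliMean p E (fun S => G S * (Y S / (2 * s ^ 2)))) := by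
    simp only [mul_sub, mul_one, sub]
    simp only [hG, sub, add, const, hJ]
    ring
  rw [hmain]
  refine (abs_sub _ _).trans (add_le_add ?_ herr)
  rw [← const_mul]
  refine (abs_le h0 h1).trans (mono h0 h1 fun S _ => ?_)
  rw [abs_mul]
  refine mul_le_mul_of_nonneg_right (_root_.abs_le.2 ?_) (abs_nonneg _)
  have := gaussianCDF_nonneg z
  have := gaussianCDF_le_one z
  constructor <;> linarith [hJ0 (W S), hf (W S)]

/-- A Berry-Esseen bound for sums of functions of blocks of independent Bernoulli variables. -/
theorem abs_bernoulliMean_sub_gaussianCDF_le_of_variance_le (h0 : 0 ≤ p) (h1 : p ≤ 1)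
    (hI : ∀ v S, I v (S ∩ B v) = I v S) (hX : ∀ S, X S = ∑ v, I v S) {s : ℝ} (hs : 0 < s)
    (hvar : s ^ 2 = bernoulliMean p E (fun S => (X S - bernoulliMean p E X) ^ 2)) {M : ℝ}
    (hM1 : bernoulliMean p E
        (fun S => resamplingSum p E B (fun v S T => I v S - I v T) X S ^ 2) -
      bernoulliMean p E (resamplingSum p E B (fun v S T => I v S - I v T) X) ^ 2 ≤ M)
    (hM2 : bernoulliMean p E
        (fun S => resamplingSum p E B (fun v S T => |I v S - I v T|) X S ^ 2) -
      bernoulliMean p E (resamplingSum p E B (fun v S T => |I v S - I v T|) X) ^ 2 ≤ M) (z : ℝ) :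
    |bernoulliMean p E (fun S => if (X S - bernoulliMean p E X) / s ≤ z then 1 else 0) -
        gaussianCDF z| ≤ 3 * √M / s ^ 2 := by
  refine (abs_bernoulliMean_sub_gaussianCDF_le h0 h1 hI hX hs z).trans ?_
  rw [bernoulliMean_resamplingSum_abs_sub hI, zero_pow two_ne_zero, sub_zero] at hM2
  rw [← sq_sub_mean, bernoulliMean_resamplingSum_sub hI hX, ← hvar] at hM1
  have e1 := (abs_le_sqrt h0 h1).trans (Real.sqrt_le_sqrt hM1)
  have e2 := (abs_le_sqrt h0 h1).trans (Real.sqrt_le_sqrt hM2)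
  have e3 (y : ℝ) : |1 - y / (2 * s ^ 2)| = (2 * s ^ 2)⁻¹ * |y - 2 * s ^ 2| := by
    rw [abs_sub_comm, ← abs_of_pos (by positivity : 0 < (2 * s ^ 2)⁻¹), ← abs_mul]
    congr 1
    field_simp
  simp only [e3, const_mul]
  have hs2 : 0 < s ^ 2 := by positivity
  -- The constant 3 is 1 from the fluctuation of the signed sum about `2 * s ^ 2` plus 2 from the
  -- absolute one.
  calc _ = (bernoulliMean p E (fun S =>
        |resamplingSum p E B (fun v S T => I v S - I v T) X S - 2 * s ^ 2|) +
      2 * bernoulliMean p E (fun S =>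
        |resamplingSum p E B (fun v S T => |I v S - I v T|) X S|)) / s ^ 2 := by field_simp
    _ ≤ _ := by gcongr; linarith

end SteinMethod

/-! ### Edge sets, degrees and the effect of resampling a star -/

section EdgeSets

variable {V : Type*} [DecidableEq V]

/-- The indicator that `u` and `v` are joined by an edge in `S`. -/
def edgeIndicator (S : Finset (Sym2 V)) (u v : V) : ℝ := if u ≠ v ∧ s(u, v) ∈ S then 1 else 0

theorem edgeIndicator_nonneg (S : Finset (Sym2 V)) (u v : V) : 0 ≤ edgeIndicator S u v := by
  unfold edgeIndicator
  split_ifs <;> norm_num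

theorem edgeIndicator_le_one (S : Finset (Sym2 V)) (u v : V) : edgeIndicator S u v ≤ 1 := by
  unfold edgeIndicator
  split_ifs <;> norm_num

theorem edgeIndicator_comm (S : Finset (Sym2 V)) (u v : V) :
    edgeIndicator S u v = edgeIndicator S v u := by
  simp only [edgeIndicator, Sym2.eq_swap (a := u), ne_comm (a := u)]

theorem edgeIndicator_congr_of_not_mem {S T : Finset (Sym2 V)} {e : Sym2 V} {u : V} (hu : u ∉ e)
    (h : ∀ e', e' ≠ e → (e' ∈ S ↔ e' ∈ T)) (v : V) :
    edgeIndicator S v u = edgeIndicator T v u := by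
  have h1 : s(v, u) ∈ S ↔ s(v, u) ∈ T := h _ (by rintro rfl; simp at hu)
  simp only [edgeIndicator, h1]

variable [Fintype V]

variable (V) in
/-- The edges of the complete graph on `V`. -/
def completeEdges : Finset (Sym2 V) := Finset.univ.filter fun e => ¬ e.IsDiag

/-- The edges of the complete graph at the vertex `v`. -/
def starEdges (v : V) : Finset (Sym2 V) := (completeEdges V).filter fun e => v ∈ e

/-- The degree of `u` in the graph with edge set `S`. -/
def edgeDegree (S : Finset (Sym2 V)) (u : V) : ℕ :=
  (Finset.univ.filter fun v => u ≠ v ∧ s(u, v) ∈ S).card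

theorem mem_completeEdges {e : Sym2 V} : e ∈ completeEdges V ↔ ¬ e.IsDiag := by
  simp [completeEdges]

theorem mk_mem_completeEdges {u v : V} : s(u, v) ∈ completeEdges V ↔ u ≠ v := by
  simp [completeEdges]

theorem mem_starEdges {v : V} {e : Sym2 V} : e ∈ starEdges v ↔ ¬ e.IsDiag ∧ v ∈ e := by
  simp [starEdges, mem_completeEdges]

theorem starEdges_subset (v : V) : starEdges v ⊆ completeEdges V := Finset.filter_subset _ _

theorem eq_mk_of_mem_starEdges {u v : V} (huv : u ≠ v) {e : Sym2 V} (hu : e ∈ starEdges u)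
    (hv : e ∈ starEdges v) : e = s(u, v) :=
  (Sym2.mem_and_mem_iff huv).1 ⟨(mem_starEdges.1 hu).2, (mem_starEdges.1 hv).2⟩

theorem sum_edgeIndicator (S : Finset (Sym2 V)) (u : V) :
    ∑ v, edgeIndicator S u v = edgeDegree S u := by
  simp [edgeIndicator, edgeDegree]

theorem sum_edgeIndicator' (S : Finset (Sym2 V)) (u : V) :
    ∑ v, edgeIndicator S v u = edgeDegree S u := by
  simp only [edgeIndicator_comm S _ u, sum_edgeIndicator]

theorem edgeDegree_congr {S T : Finset (Sym2 V)} {u : V}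
    (h : S ∩ starEdges u = T ∩ starEdges u) : edgeDegree S u = edgeDegree T u := by
  unfold edgeDegree
  congr 1
  ext v
  have h1 := Finset.ext_iff.1 h s(u, v)
  simp only [Finset.mem_inter, mem_starEdges, Sym2.mk_isDiag_iff, Sym2.mem_mk_left, and_true] at h1
  simp only [Finset.mem_filter, Finset.mem_univ, true_and]
  tauto

theorem edgeDegree_inter_starEdges (S : Finset (Sym2 V)) (u : V) :
    edgeDegree (S ∩ starEdges u) u = edgeDegree S u :=
  edgeDegree_congr (by rw [Finset.inter_assoc, Finset.inter_self])

theorem edgeDegree_mono {S T : Finset (Sym2 V)} (h : S ⊆ T) (u : V) :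
    edgeDegree S u ≤ edgeDegree T u :=
  Finset.card_le_card (Finset.monotone_filter_right _ fun _ _ hv => ⟨hv.1, h hv.2⟩)

theorem edgeDegree_insert_le {S : Finset (Sym2 V)} {e : Sym2 V} {u : V} (hu : u ∈ e) :
    edgeDegree (insert e S) u ≤ edgeDegree S u + 1 := by
  obtain ⟨w, rfl⟩ := hu
  refine (Finset.card_le_card fun v hv => ?_).trans (Finset.card_insert_le w _)
  simp only [Finset.mem_filter, Finset.mem_univ, true_and, Finset.mem_insert,
    Sym2.congr_right] at hv ⊢
  tauto

/-- The stars at `u` and `v` share only the edge `s(u, v)`, which is absent before and after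
resampling. -/
theorem edgeDegree_resample {S T : Finset (Sym2 V)} {u v : V} (huv : u ≠ v) (hS : s(u, v) ∉ S)
    (hT : s(u, v) ∉ T) : edgeDegree (resample (starEdges v) S T) u = edgeDegree S u := by
  refine edgeDegree_congr ?_
  ext e
  have h : e ∈ starEdges u → e ∈ starEdges v → e = s(u, v) := eq_mk_of_mem_starEdges huv
  simp only [Finset.mem_inter, mem_resample]
  constructor
  · rintro ⟨⟨h1, _⟩ | ⟨h1, h2⟩, h3⟩
    · exact ⟨h1, h3⟩
    · exact (hT (h h3 h2 ▸ h1)).elim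
  · rintro ⟨h1, h3⟩
    exact ⟨Or.inl ⟨h1, fun h2 => hS (h h3 h2 ▸ h1)⟩, h3⟩

theorem abs_sub_resample_le {J : ℕ → ℝ} (hJ : ∀ a b, |J a - J b| ≤ 1) (S T : Finset (Sym2 V))
    {u v : V} (huv : u ≠ v) :
    |J (edgeDegree S u) - J (edgeDegree (resample (starEdges v) S T) u)| ≤
      edgeIndicator S u v + edgeIndicator T u v := by
  by_cases hS : s(u, v) ∈ S
  · have : edgeIndicator S u v = 1 := if_pos ⟨huv, hS⟩
    linarith [edgeIndicator_nonneg T u v, hJ (edgeDegree S u)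
      (edgeDegree (resample (starEdges v) S T) u)]
  by_cases hT : s(u, v) ∈ T
  · have : edgeIndicator T u v = 1 := if_pos ⟨huv, hT⟩
    linarith [edgeIndicator_nonneg S u v, hJ (edgeDegree S u)
      (edgeDegree (resample (starEdges v) S T) u)]
  rw [edgeDegree_resample huv hS hT, sub_self, abs_zero]
  exact add_nonneg (edgeIndicator_nonneg _ _ _) (edgeIndicator_nonneg _ _ _)

/-- Only `v` itself, which accounts for the 1, and its neighbours in `S` or `T` can change degree.
-/
theorem abs_sum_sub_resample_le {J : ℕ → ℝ} (hJ : ∀ a b, |J a - J b| ≤ 1) (S T : Finset (Sym2 V))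
    (v : V) :
    |∑ u, J (edgeDegree S u) - ∑ u, J (edgeDegree (resample (starEdges v) S T) u)| ≤
      1 + edgeDegree S v + edgeDegree T v := by
  rw [← Finset.sum_sub_distrib, ← sum_edgeIndicator', ← sum_edgeIndicator', add_assoc,
    ← Finset.sum_add_distrib]
  have h1 : (1 : ℝ) = ∑ u : V, if u = v then 1 else 0 := by simp
  rw [h1, ← Finset.sum_add_distrib]
  refine (Finset.abs_sum_le_sum_abs _ _).trans (Finset.sum_le_sum fun u _ => ?_)
  have h2 := edgeIndicator_nonneg S u v
  have h3 := edgeIndicator_nonneg T u v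
  split_ifs with h
  · linarith [hJ (edgeDegree S u) (edgeDegree (resample (starEdges v) S T) u)]
  · rw [zero_add]
    exact abs_sub_resample_le hJ S T h

theorem edgeDegree_congr_of_not_mem {S T : Finset (Sym2 V)} {e : Sym2 V} {u : V} (hu : u ∉ e)
    (h : ∀ e', e' ≠ e → (e' ∈ S ↔ e' ∈ T)) : edgeDegree S u = edgeDegree T u := by
  refine edgeDegree_congr ?_
  ext e'
  simp only [Finset.mem_inter, mem_starEdges]
  have h1 : u ∈ e' → (e' ∈ S ↔ e' ∈ T) := fun h' => h e' (by rintro rfl; exact hu h')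
  tauto

/-- The change of `X S - X (resample (starEdges v) S T)` under a change of `S` at an edge that is
not incident to `v`. -/
theorem abs_resample_sub_resample_le {J : ℕ → ℝ} (hJ : ∀ a b, |J a - J b| ≤ 1)
    {S S' : Finset (Sym2 V)} (T : Finset (Sym2 V)) {e : Sym2 V} {v : V} (hv : v ∉ e)
    (h : ∀ e', e' ≠ e → (e' ∈ S ↔ e' ∈ S')) :
    |(∑ u, J (edgeDegree S u) - ∑ u, J (edgeDegree (resample (starEdges v) S T) u)) -
      (∑ u, J (edgeDegree S' u) - ∑ u, J (edgeDegree (resample (starEdges v) S' T) u))| ≤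
      ∑ u, if u ∈ e then 2 * (edgeIndicator S u v + edgeIndicator T u v) else 0 := by
  rw [← Finset.sum_sub_distrib, ← Finset.sum_sub_distrib, ← Finset.sum_sub_distrib]
  refine (Finset.abs_sum_le_sum_abs _ _).trans (Finset.sum_le_sum fun u _ => ?_)
  split_ifs with hu
  · have huv : u ≠ v := by rintro rfl; exact hv hu
    have h1 := abs_sub_resample_le hJ S T huv
    have h2 := abs_sub_resample_le hJ S' T huv
    rw [← edgeIndicator_congr_of_not_mem hv h] at h2
    exact (abs_sub _ _).trans (by linarith)
  · rw [edgeDegree_congr_of_not_mem hu h, edgeDegree_congr_of_not_mem hu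
      (S := resample (starEdges v) S T) (T := resample (starEdges v) S' T), sub_self, abs_zero]
    intro e' he'
    simp only [mem_resample, h e' he']

end EdgeSets

/-! ### Moments of degrees and the variance of the resampling sums -/

section DegreeMean

open bernoulliMean

variable {V : Type*} [Fintype V] [DecidableEq V] {p : ℝ}

theorem bernoulliMean_edgeIndicator_le (h0 : 0 ≤ p) (u v : V) :
    bernoulliMean p (completeEdges V) (fun S => edgeIndicator S u v) ≤ p := by
  by_cases h : u = v
  · simpa [edgeIndicator, h, const] using h0
  · simp only [edgeIndicator, ne_eq, h, not_false_eq_true, true_and]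
    rw [mem (mk_mem_completeEdges.2 h)]

theorem bernoulliMean_edgeDegree_le (h0 : 0 ≤ p) (u : V) :
    bernoulliMean p (completeEdges V) (fun S => (edgeDegree S u : ℝ)) ≤ Fintype.card V * p := by
  simp only [← sum_edgeIndicator, sum]
  refine (Finset.sum_le_sum fun v _ => bernoulliMean_edgeIndicator_le h0 u v).trans ?_
  simp

theorem bernoulliMean_edgeDegree_sq_le (h0 : 0 ≤ p) (h1 : p ≤ 1) (u : V) :
    bernoulliMean p (completeEdges V) (fun S => (edgeDegree S u : ℝ) ^ 2) ≤
      Fintype.card V * p + (Fintype.card V * p) ^ 2 := by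
  have h (v w : V) : bernoulliMean p (completeEdges V)
      (fun S => edgeIndicator S u v * edgeIndicator S u w) ≤ (if v = w then p else 0) + p * p := by
    split_ifs with hvw
    · refine (mono h0 h1 fun S _ => mul_le_of_le_one_right (edgeIndicator_nonneg _ _ _)
        (edgeIndicator_le_one _ _ _)).trans ((bernoulliMean_edgeIndicator_le h0 u v).trans ?_)
      nlinarith
    · rw [zero_add, mul_of_disjoint (A := {s(u, v)}) (B := {s(u, w)})]
      · exact mul_le_mul (bernoulliMean_edgeIndicator_le h0 u v)
          (bernoulliMean_edgeIndicator_le h0 u w)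
          (nonneg h0 h1 fun S _ => edgeIndicator_nonneg _ _ _) h0
      · simp only [Finset.disjoint_singleton, ne_eq, Sym2.congr_right]
        exact hvw
      · intro S
        simp [edgeIndicator]
      · intro S
        simp [edgeIndicator]
  simp only [sq, ← sum_edgeIndicator, Finset.sum_mul_sum, sum]
  refine (Finset.sum_le_sum fun v _ => Finset.sum_le_sum fun w _ => h v w).trans ?_
  simp only [Finset.sum_add_distrib, Finset.sum_ite_eq, Finset.mem_univ, if_true,
    Finset.sum_const, Finset.card_univ, nsmul_eq_mul]
  exact le_of_eq (by ring)

theorem card_completeEdges_le : ((completeEdges V).card : ℝ) ≤ (Fintype.card V : ℝ) ^ 2 := by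
  have h : (completeEdges V).card ≤ Fintype.card V ^ 2 := by
    rw [sq, ← Fintype.card_prod]
    exact (Finset.card_le_univ _).trans (Fintype.card_le_of_surjective
      (fun x : V × V => s(x.1, x.2)) fun e => by
        induction e using Sym2.ind with
        | _ x y => exact ⟨(x, y), rfl⟩)
  exact_mod_cast h

theorem card_filter_mem_le_two (e : Sym2 V) : (Finset.univ.filter fun u => u ∈ e).card ≤ 2 := by
  induction e using Sym2.ind with
  | _ x y =>
    refine (Finset.card_le_card (t := {x, y}) fun u hu => ?_).trans Finset.card_le_two
    simpa using hu

/-- The change at an edge of the resampling sum of a function of the degrees. -/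
theorem abs_resamplingSum_sub_le (h0 : 0 ≤ p) (h1 : p ≤ 1) {J : ℕ → ℝ}
    (hJ : ∀ a b, |J a - J b| ≤ 1) {φ : ℕ → ℕ → ℝ} (hφ : ∀ a b, |φ a b| ≤ 1)
    (S : Finset (Sym2 V)) (e : Sym2 V) :
    |resamplingSum p (completeEdges V) starEdges
        (fun v S T => φ (edgeDegree S v) (edgeDegree T v))
        (fun S => ∑ u, J (edgeDegree S u)) (insert e S) -
      resamplingSum p (completeEdges V) starEdges
        (fun v S T => φ (edgeDegree S v) (edgeDegree T v))
        (fun S => ∑ u, J (edgeDegree S u)) (S.erase e)| ≤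
      ∑ u with u ∈ e, 4 * (1 + edgeDegree S u + Fintype.card V * p) := by
  set K : ℝ := Fintype.card V * p with hK
  have hK0 : 0 ≤ K := by positivity
  set X : Finset (Sym2 V) → ℝ := fun S => ∑ u, J (edgeDegree S u) with hX
  set D : V → Finset (Sym2 V) → Finset (Sym2 V) → ℝ := fun v S T =>
    φ (edgeDegree S v) (edgeDegree T v) * (X S - X (resample (starEdges v) S T)) with hD
  have hτ (v : V) (S : Finset (Sym2 V)) :
      |bernoulliMean p (completeEdges V) (D v S)| ≤ 1 + edgeDegree S v + K := by
    refine (abs_le h0 h1).trans ((mono h0 h1 fun T _ => ?_ : _ ≤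
      bernoulliMean p (completeEdges V) fun T => (1 + edgeDegree S v) + (edgeDegree T v : ℝ)).trans ?_)
    · rw [abs_mul]
      refine (mul_le_of_le_one_left (abs_nonneg _) (hφ _ _)).trans ?_
      exact abs_sum_sub_resample_le hJ S T v
    · rw [add, const]
      linarith [bernoulliMean_edgeDegree_le h0 v]
  -- If `v ∈ e`, both values are bounded separately by `hτ`. If `v ∉ e`, the edge matters only
  -- through an endpoint `u` joined to `v` in `S` or `T`; summed over `v`, such terms again give the
  -- degree of `u`.
  have hb (v : V) : |bernoulliMean p (completeEdges V) (D v (insert e S)) -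
      bernoulliMean p (completeEdges V) (D v (S.erase e))| ≤
      (if v ∈ e then 2 * (2 + edgeDegree S v + K) else 0) +
        ∑ u, if u ∈ e then 2 * (edgeIndicator S u v + p) else 0 := by
    have hnn : 0 ≤ ∑ u, if u ∈ e then 2 * (edgeIndicator S u v + p) else 0 :=
      Finset.sum_nonneg fun u _ => by
        have := edgeIndicator_nonneg S u v
        split_ifs <;> positivity
    split_ifs with hv
    · have hi : (edgeDegree (insert e S) v : ℝ) ≤ edgeDegree S v + 1 := by
        exact_mod_cast edgeDegree_insert_le hv
      have he : (edgeDegree (S.erase e) v : ℝ) ≤ edgeDegree S v := by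
        exact_mod_cast edgeDegree_mono (Finset.erase_subset e S) v
      linarith [abs_sub (bernoulliMean p (completeEdges V) (D v (insert e S)))
        (bernoulliMean p (completeEdges V) (D v (S.erase e))), hτ v (insert e S), hτ v (S.erase e)]
    · have hc : ∀ e', e' ≠ e → (e' ∈ insert e S ↔ e' ∈ S.erase e) := fun e' he' => by
        simp [he']
      have hc' : ∀ e', e' ≠ e → (e' ∈ insert e S ↔ e' ∈ S) := fun e' he' => by
        simp [he']
      rw [zero_add, ← sub]
      refine (abs_le h0 h1).trans ((mono h0 h1 fun T _ => ?_ : _ ≤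
        bernoulliMean p (completeEdges V) fun T => ∑ u, if u ∈ e then
          2 * (edgeIndicator S u v + edgeIndicator T u v) else 0).trans ?_)
      · simp only [hD]
        rw [edgeDegree_congr_of_not_mem hv hc, ← mul_sub, abs_mul]
        refine (mul_le_of_le_one_left (abs_nonneg _) (hφ _ _)).trans ?_
        refine (abs_resample_sub_resample_le hJ T hv hc).trans (le_of_eq ?_)
        exact Finset.sum_congr rfl fun u _ => by rw [edgeIndicator_congr_of_not_mem hv hc']
      · rw [sum]
        refine Finset.sum_le_sum fun u _ => ?_
        split_ifs with hu
        · rw [const_mul, add, const]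
          linarith [bernoulliMean_edgeIndicator_le h0 u v]
        · rw [const]
  unfold resamplingSum
  rw [← Finset.sum_sub_distrib]
  refine (Finset.abs_sum_le_sum_abs _ _).trans ((Finset.sum_le_sum fun v _ => hb v).trans
    (le_of_eq ?_))
  rw [Finset.sum_add_distrib, Finset.sum_comm, ← Finset.sum_add_distrib, Finset.sum_filter]
  refine Finset.sum_congr rfl fun u _ => ?_
  split_ifs with hu
  · rw [← Finset.mul_sum, Finset.sum_add_distrib, sum_edgeIndicator, Finset.sum_const,
      Finset.card_univ, nsmul_eq_mul, ← hK]
    ring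
  · simp

theorem variance_resamplingSum_le (h0 : 0 ≤ p) (h1 : p ≤ 1) {J : ℕ → ℝ}
    (hJ : ∀ a b, |J a - J b| ≤ 1) {φ : ℕ → ℕ → ℝ} (hφ : ∀ a b, |φ a b| ≤ 1) :
    bernoulliMean p (completeEdges V) (fun S => resamplingSum p (completeEdges V) starEdges
        (fun v S T => φ (edgeDegree S v) (edgeDegree T v))
        (fun S => ∑ u, J (edgeDegree S u)) S ^ 2) -
      bernoulliMean p (completeEdges V) (resamplingSum p (completeEdges V) starEdges
        (fun v S T => φ (edgeDegree S v) (edgeDegree T v))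
        (fun S => ∑ u, J (edgeDegree S u))) ^ 2 ≤
      192 * (1 + Fintype.card V * p + 2 * (Fintype.card V * p) ^ 2) *
        ((Fintype.card V : ℝ) ^ 2 * p) := by
  set K : ℝ := Fintype.card V * p with hK
  have hK0 : 0 ≤ K := by positivity
  have hM (u : V) : bernoulliMean p (completeEdges V)
      (fun S => (4 * (1 + edgeDegree S u + K)) ^ 2) ≤ 48 * (1 + K + 2 * K ^ 2) := by
    -- 48 is 16 times the 3 from the square of a sum of three terms. The two endpoints of an edge
    -- later contribute a factor 2 by Cauchy-Schwarz and another 2 by summation, which gives 192.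
    refine (mono h0 h1 fun S _ => ?_ : _ ≤ bernoulliMean p (completeEdges V) fun S =>
      48 * ((1 + K ^ 2) + (edgeDegree S u : ℝ) ^ 2)).trans ?_
    · nlinarith [sq_nonneg ((edgeDegree S u : ℝ) - 1), sq_nonneg ((edgeDegree S u : ℝ) - K),
        sq_nonneg (K - 1)]
    · rw [const_mul, add, const]
      linarith [bernoulliMean_edgeDegree_sq_le h0 h1 u]
  have hM0 : 0 ≤ 48 * (1 + K + 2 * K ^ 2) := by positivity
  have he (e : Sym2 V) : bernoulliMean p (completeEdges V) (fun S =>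
      (resamplingSum p (completeEdges V) starEdges
        (fun v S T => φ (edgeDegree S v) (edgeDegree T v))
        (fun S => ∑ u, J (edgeDegree S u)) (insert e S) -
      resamplingSum p (completeEdges V) starEdges
        (fun v S T => φ (edgeDegree S v) (edgeDegree T v))
        (fun S => ∑ u, J (edgeDegree S u)) (S.erase e)) ^ 2) ≤
      2 * (2 * (48 * (1 + K + 2 * K ^ 2))) := by
    have hc : ((Finset.univ.filter fun u => u ∈ e).card : ℝ) ≤ 2 := by
      exact_mod_cast card_filter_mem_le_two e
    refine (mono h0 h1 fun S _ => ?_ : _ ≤ bernoulliMean p (completeEdges V) fun S =>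
      2 * ∑ u with u ∈ e, (4 * (1 + edgeDegree S u + K)) ^ 2).trans ?_
    · rw [← sq_abs]
      refine (pow_le_pow_left₀ (abs_nonneg _) (abs_resamplingSum_sub_le h0 h1 hJ hφ S e) 2).trans ?_
      refine sq_sum_le_card_mul_sum_sq.trans (mul_le_mul_of_nonneg_right hc ?_)
      exact Finset.sum_nonneg fun u _ => sq_nonneg _
    · rw [const_mul, sum]
      refine mul_le_mul_of_nonneg_left ((Finset.sum_le_sum fun u _ => hM u).trans ?_) zero_le_two
      rw [Finset.sum_const, nsmul_eq_mul]
      exact mul_le_mul_of_nonneg_right hc hM0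
  refine (variance_le h0 h1).trans ?_
  have hs := (Finset.sum_le_sum fun e (_ : e ∈ completeEdges V) => he e).trans_eq
    (by rw [Finset.sum_const, nsmul_eq_mul])
  have hs' := hs.trans (mul_le_mul_of_nonneg_right card_completeEdges_le (by positivity))
  refine (mul_le_mul_of_nonneg_left hs' (mul_nonneg h0 (sub_nonneg.2 h1))).trans ?_
  have : 0 ≤ p ^ 2 * ((Fintype.card V : ℝ) ^ 2 * (2 * (2 * (48 * (1 + K + 2 * K ^ 2))))) := by
    positivity
  nlinarith

end DegreeMean

/-! ### The binomial law of a degree and the lower bound for the variance -/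

section BinomialLaw

open bernoulliMean

/-- The mean of `ψ k` for a binomial random variable `k` with parameters `n` and `p`. -/
noncomputable def binomialMean (p : ℝ) (n : ℕ) (ψ : ℕ → ℝ) : ℝ :=
  ∑ k ∈ Finset.range (n + 1), n.choose k • (p ^ k * (1 - p) ^ (n - k) * ψ k)

theorem bernoulliMean_card_inter {ι : Type*} [DecidableEq ι] {p : ℝ} {A E : Finset ι}
    (hA : A ⊆ E) (ψ : ℕ → ℝ) :
    bernoulliMean p E (fun S => ψ (S ∩ A).card) = binomialMean p A.card ψ := by
  rw [of_subset hA fun S => by rw [Finset.inter_assoc, Finset.inter_self],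
    congr (g := fun S => ψ S.card) fun S hS => by rw [Finset.inter_eq_left.2 hS]]
  exact Finset.sum_powerset_apply_card
    (fun k => p ^ k * (1 - p) ^ (A.card - k) * ψ k) (x := A)

theorem binomialMean_indicator (p : ℝ) (n d : ℕ) :
    binomialMean p n (fun k => if k = d then 1 else 0) =
      n.choose d * (p ^ d * (1 - p) ^ (n - d)) := by
  rw [binomialMean, Finset.sum_eq_single d]
  · simp
  · intro k _ hk
    simp [hk]
  · intro h
    rw [Nat.choose_eq_zero_of_lt (by simpa using h), zero_smul]

variable {V : Type*} [Fintype V] [DecidableEq V] {p : ℝ}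

theorem edgeDegree_eq_card_inter (S : Finset (Sym2 V)) (u : V) :
    edgeDegree S u = (S ∩ starEdges u).card := by
  have h : S ∩ starEdges u =
      (Finset.univ.filter fun v => u ≠ v ∧ s(u, v) ∈ S).image fun v => s(u, v) := by
    ext e
    simp only [Finset.mem_inter, mem_starEdges, Finset.mem_image, Finset.mem_filter,
      Finset.mem_univ, true_and]
    constructor
    · rintro ⟨h1, h2, ⟨v, rfl⟩⟩
      exact ⟨v, ⟨by simpa using h2, h1⟩, rfl⟩
    · rintro ⟨v, ⟨h1, h2⟩, rfl⟩
      exact ⟨h2, by simpa using h1, by simp⟩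
  rw [h, Finset.card_image_of_injective _ fun v w hvw => Sym2.congr_right.1 hvw]
  rfl

theorem card_starEdges (u : V) : (starEdges u).card = Fintype.card V - 1 := by
  rw [← Finset.inter_eq_right.2 (starEdges_subset u), ← edgeDegree_eq_card_inter, edgeDegree,
    ← Finset.card_univ, ← Finset.card_erase_of_mem (Finset.mem_univ u)]
  congr 1
  ext v
  simp [mk_mem_completeEdges, eq_comm]

theorem bernoulliMean_edgeDegree (J : ℕ → ℝ) (u : V) :
    bernoulliMean p (completeEdges V) (fun S => J (edgeDegree S u)) =
      binomialMean p (Fintype.card V - 1) J := by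
  simp only [edgeDegree_eq_card_inter, bernoulliMean_card_inter (starEdges_subset u),
    card_starEdges]

/-- Functions of the degrees of two vertices are nonnegatively correlated if they are equal. -/
theorem bernoulliMean_mul_le_of_ne (h0 : 0 ≤ p) (h1 : p ≤ 1) (J : ℕ → ℝ) {u v : V} (huv : u ≠ v) :
    bernoulliMean p (completeEdges V) (fun S => J (edgeDegree S u)) *
        bernoulliMean p (completeEdges V) (fun S => J (edgeDegree S v)) ≤
      bernoulliMean p (completeEdges V) (fun S => J (edgeDegree S u) * J (edgeDegree S v)) := by
  set e := s(u, v) with he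
  set E := (completeEdges V).erase e with hE
  set A : V → Finset (Sym2 V) := fun w => (starEdges w).erase e with hA
  have heE : e ∉ E := Finset.notMem_erase _ _
  have hins : completeEdges V = insert e E :=
    (Finset.insert_erase (mk_mem_completeEdges.2 huv)).symm
  have hAE (w : V) : A w ⊆ E := Finset.erase_subset_erase _ (starEdges_subset w)
  have hmem {w : V} (hw : w ∈ e) : e ∈ starEdges w :=
    mem_starEdges.2 ⟨by simpa [he] using huv, hw⟩
  have hd0 (w : V) : ∀ S ⊆ E, edgeDegree S w = (S ∩ A w).card := fun S hS => by
    rw [edgeDegree_eq_card_inter]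
    congr 1
    ext e'
    simp only [hA, Finset.mem_inter, Finset.mem_erase]
    have : e' ∈ S → e' ≠ e := fun h => by rintro rfl; exact heE (hS h)
    tauto
  have hd1 {w : V} (hw : w ∈ e) :
      ∀ S ⊆ E, edgeDegree (insert e S) w = (S ∩ A w).card + 1 := fun S hS => by
    rw [edgeDegree_eq_card_inter, Finset.insert_inter_of_mem (hmem hw),
      Finset.card_insert_of_notMem (fun h => heE (hS (Finset.mem_inter.1 h).1)),
      ← edgeDegree_eq_card_inter, hd0 w S hS]
  have hdisj : Disjoint (A u) (A v) := Finset.disjoint_left.2 fun e' h h' => by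
    rw [Finset.mem_erase] at h h'
    exact h.1 (eq_mk_of_mem_starEdges huv h.2 h'.2)
  have hcard {w : V} (hw : w ∈ e) : (A w).card = Fintype.card V - 1 - 1 := by
    rw [← card_starEdges w, Finset.card_erase_of_mem (hmem hw)]
  have hu : u ∈ e := by simp [he]
  have hv : v ∈ e := by simp [he]
  -- The conditional means given that the edge `s(u, v)` is absent or present. Given its state the
  -- two degrees are independent with equal laws, so the covariance is `p * (1 - p) * (a - b) ^ 2`.
  set a := binomialMean p (Fintype.card V - 1 - 1) J with ha
  set b := binomialMean p (Fintype.card V - 1 - 1) (fun k => J (k + 1)) with hb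
  have hm {w : V} (hw : w ∈ e) : bernoulliMean p (completeEdges V)
      (fun S => J (edgeDegree S w)) = (1 - p) * a + p * b := by
    rw [hins, bernoulliMean.insert heE, bernoulliMean.congr fun S hS => by rw [hd0 w S hS],
      bernoulliMean.congr (f := fun S => J (edgeDegree (Insert.insert e S) w)) fun S hS => by rw [hd1 hw S hS],
      bernoulliMean_card_inter (hAE w) J, bernoulliMean_card_inter (hAE w) fun k => J (k + 1),
      hcard hw]
  have hprod (ψ : ℕ → ℝ) : bernoulliMean p E (fun S => ψ (S ∩ A u).card * ψ (S ∩ A v).card) =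
      binomialMean p (Fintype.card V - 1 - 1) ψ ^ 2 := by
    rw [mul_of_disjoint hdisj (fun S => by rw [Finset.inter_assoc, Finset.inter_self])
      (fun S => by rw [Finset.inter_assoc, Finset.inter_self]), bernoulliMean_card_inter (hAE u),
      bernoulliMean_card_inter (hAE v), hcard hu, hcard hv, sq]
  have hm2 : bernoulliMean p (completeEdges V)
      (fun S => J (edgeDegree S u) * J (edgeDegree S v)) = (1 - p) * a ^ 2 + p * b ^ 2 := by
    rw [hins, bernoulliMean.insert heE, bernoulliMean.congr fun S hS => by rw [hd0 u S hS, hd0 v S hS],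
      bernoulliMean.congr (f := fun S => J (edgeDegree (Insert.insert e S) u) *
        J (edgeDegree (Insert.insert e S) v)) fun S hS => by rw [hd1 hu S hS, hd1 hv S hS],
      hprod J, hprod fun k => J (k + 1)]
  rw [hm hu, hm hv, hm2]
  nlinarith [mul_nonneg (mul_nonneg h0 (sub_nonneg.2 h1)) (sq_nonneg (a - b))]

theorem card_mul_le_variance (h0 : 0 ≤ p) (h1 : p ≤ 1) (J : ℕ → ℝ) :
    Fintype.card V * (binomialMean p (Fintype.card V - 1) (fun k => J k ^ 2) -
        binomialMean p (Fintype.card V - 1) J ^ 2) ≤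
      bernoulliMean p (completeEdges V) (fun S => (∑ u, J (edgeDegree S u)) ^ 2) -
        bernoulliMean p (completeEdges V) (fun S => ∑ u, J (edgeDegree S u)) ^ 2 := by
  have h (u v : V) : (if u = v then binomialMean p (Fintype.card V - 1) (fun k => J k ^ 2) -
        binomialMean p (Fintype.card V - 1) J ^ 2 else 0) ≤
      bernoulliMean p (completeEdges V) (fun S => J (edgeDegree S u) * J (edgeDegree S v)) -
      bernoulliMean p (completeEdges V) (fun S => J (edgeDegree S u)) *
        bernoulliMean p (completeEdges V) (fun S => J (edgeDegree S v)) := by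
    split_ifs with huv
    · subst huv
      simp only [← sq]
      rw [bernoulliMean_edgeDegree, bernoulliMean_edgeDegree fun k => J k ^ 2]
    · exact sub_nonneg.2 (bernoulliMean_mul_le_of_ne h0 h1 J huv)
  simp only [sq (∑ u, J (edgeDegree _ u)), sum]
  rw [sq (∑ u, _), Finset.sum_mul_sum]
  simp only [Finset.sum_mul_sum, sum, ← Finset.sum_sub_distrib]
  refine le_trans (le_of_eq ?_) (Finset.sum_le_sum fun u _ => Finset.sum_le_sum fun v _ => h u v)
  simp [mul_sub]

theorem binomialMean_add_le_one (h0 : 0 ≤ p) (h1 : p ≤ 1) (n : ℕ) {d d' : ℕ} (hd : d ≠ d') :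
    binomialMean p n (fun k => if k = d then 1 else 0) +
      binomialMean p n (fun k => if k = d' then 1 else 0) ≤ 1 := by
  have h (ψ : ℕ → ℝ) : binomialMean p n ψ =
      bernoulliMean p (Finset.range n) (fun S => ψ (S ∩ Finset.range n).card) := by
    rw [bernoulliMean_card_inter subset_rfl, Finset.card_range]
  rw [h, h, ← add]
  refine le_of_le_of_eq (mono (g := fun _ => 1) h0 h1 fun S _ => ?_) one
  split_ifs with h2 h3
  · exact absurd (h2.symm.trans h3) hd
  all_goals norm_num

/-- The variance of the number of vertices of degree `d`. -/
theorem card_mul_choose_mul_le_variance (h0 : 0 ≤ p) (h1 : p ≤ 1) {d d' : ℕ} (hd : d ≠ d') :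
    Fintype.card V * (((Fintype.card V - 1).choose d *
        (p ^ d * (1 - p) ^ (Fintype.card V - 1 - d))) *
      ((Fintype.card V - 1).choose d' * (p ^ d' * (1 - p) ^ (Fintype.card V - 1 - d')))) ≤
      bernoulliMean p (completeEdges V)
          (fun S => (∑ u, if edgeDegree S u = d then 1 else 0) ^ 2) -
        bernoulliMean p (completeEdges V)
          (fun S => ∑ u, if edgeDegree S u = d then 1 else 0) ^ 2 := by
  refine le_trans ?_ (card_mul_le_variance h0 h1 fun k => if k = d then 1 else 0)
  have h := binomialMean_add_le_one h0 h1 (Fintype.card V - 1) hd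
  simp only [ite_pow, one_pow, zero_pow two_ne_zero]
  simp only [binomialMean_indicator] at h ⊢
  have hq := sub_nonneg.2 h1
  have h2 : 0 ≤ ((Fintype.card V - 1).choose d : ℝ) *
      (p ^ d * (1 - p) ^ (Fintype.card V - 1 - d)) := by positivity
  -- An indicator of mean `q` has variance `q * (1 - q)`, and `1 - q` is at least the probability of
  -- degree `d'`.
  exact mul_le_mul_of_nonneg_left (by nlinarith) (Nat.cast_nonneg _)

end BinomialLaw

/-! ### Transfer to the random graph -/

section BinomialRandomGraph

open bernoulliMean SimpleGraph

theorem degreeCount_fromEdgeSet (n d : ℕ) (S : Finset (Sym2 (Fin n))) :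
    degreeCount n d (fromEdgeSet (S : Set (Sym2 (Fin n)))) =
      ∑ u, if edgeDegree S u = d then 1 else 0 := by
  classical
  rw [degreeCount, Finset.sum_boole]
  congr 2
  ext u
  simp only [Finset.mem_filter, Finset.mem_univ, true_and]
  rw [← card_neighborFinset_eq_degree, edgeDegree]
  have : (fromEdgeSet (S : Set (Sym2 (Fin n)))).neighborFinset u =
      Finset.univ.filter fun v => u ≠ v ∧ s(u, v) ∈ S := by
    ext v
    simp [and_comm]
  rw [← this]
  convert Iff.rfl

/-- With finitely many graphs, this makes every set and function of graphs measurable. -/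
instance {V : Type*} [Finite V] : MeasurableSingletonClass (SimpleGraph V) where
  measurableSet_singleton G := by
    rw [← edgeSet_injective.preimage_image {G}, Set.image_singleton]
    exact measurable_edgeSet (measurableSet_singleton _)

theorem integral_binomialRandom {V : Type*} [Fintype V] [DecidableEq V] (p : unitInterval)
    (f : SimpleGraph V → ℝ) : ∫ G, f G ∂(binomialRandom V p) =
      bernoulliMean p (completeEdges V) fun S => f (fromEdgeSet (S : Set (Sym2 V))) := by
  classical
  have hcard : (completeEdges V).card = (Fintype.card V).choose 2 := by
    rw [← Sym2.card_diagSet_compl, ← Set.toFinset_card]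
    congr 1
    ext e
    simp [mem_completeEdges]
  rw [integral_fintype .of_finite, bernoulliMean]
  refine Finset.sum_bij' (fun G _ => G.edgeFinset) (fun S _ => fromEdgeSet (S : Set (Sym2 V)))
    ?_ ?_ ?_ ?_ ?_
  · intro G _
    rw [Finset.mem_powerset]
    intro e he
    exact mem_completeEdges.2 (G.not_isDiag_of_mem_edgeFinset he)
  · intro S _
    exact Finset.mem_univ _
  · intro G _
    simp
  · intro S hS
    ext e
    have : e ∈ S → ¬ e.IsDiag := fun he => mem_completeEdges.1 (Finset.mem_powerset.1 hS he)
    simp only [mem_edgeFinset, edgeSet_fromEdgeSet]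
    simpa using this
  · intro G _
    have h : G.edgeSet.ncard = G.edgeFinset.card := by
      rw [← coe_edgeFinset, Set.ncard_coe_finset]
    rw [measureReal_def, binomialRandom_singleton, h, Nat.card_eq_fintype_card, hcard]
    simp

theorem abs_sub_gaussianCDF_le (n d : ℕ) (p : unitInterval)
    (hvar : 0 < Var[degreeCount n d; binomialRandom (Fin n) p]) (x : ℝ) :
    |(binomialRandom (Fin n) p).real
        {G | normalizedVar (degreeCount n d) (binomialRandom (Fin n) p) G ≤ x} -
      gaussianCDF x| ≤
      3 * √(192 * (1 + n * p + 2 * (n * p) ^ 2) * ((n : ℝ) ^ 2 * p)) /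
        Var[degreeCount n d; binomialRandom (Fin n) p] := by
  classical
  set μ := binomialRandom (Fin n) p
  have h0 : (0 : ℝ) ≤ p := p.2.1
  have h1 : (p : ℝ) ≤ 1 := p.2.2
  have hJ : ∀ a b : ℕ, |(if a = d then (1 : ℝ) else 0) - if b = d then 1 else 0| ≤ 1 := by
    intro a b
    split_ifs <;> norm_num
  have hmean : ∫ G, degreeCount n d G ∂μ = bernoulliMean p (completeEdges (Fin n))
      (fun S => ∑ u, if edgeDegree S u = d then 1 else 0) := by
    rw [integral_binomialRandom]
    simp only [degreeCount_fromEdgeSet]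
  have hV : √(Var[degreeCount n d; μ]) ^ 2 = Var[degreeCount n d; μ] := Real.sq_sqrt hvar.le
  have hvar' : Var[degreeCount n d; μ] = bernoulliMean p (completeEdges (Fin n)) (fun S =>
      ((∑ u, if edgeDegree S u = d then 1 else 0) - bernoulliMean p (completeEdges (Fin n))
        (fun S => ∑ u, if edgeDegree S u = d then 1 else 0)) ^ 2) := by
    rw [variance_eq_integral (measurable_of_finite _).aemeasurable, hmean, integral_binomialRandom]
    simp only [degreeCount_fromEdgeSet]
  have hreal : μ.real {G | normalizedVar (degreeCount n d) μ G ≤ x} =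
      bernoulliMean p (completeEdges (Fin n)) (fun S => if ((∑ u, if edgeDegree S u = d then 1 else 0) -
        bernoulliMean p (completeEdges (Fin n))
          (fun S => ∑ u, if edgeDegree S u = d then 1 else 0)) / √(Var[degreeCount n d; μ]) ≤ x
        then 1 else 0) := by
    rw [← integral_indicator_one (Set.toFinite _).measurableSet, integral_binomialRandom]
    simp only [Set.indicator_apply, Set.mem_ofPred_eq, normalizedVar, hmean, degreeCount_fromEdgeSet,
      Pi.one_apply]
  have hv1 := variance_resamplingSum_le (V := Fin n) h0 h1 hJ
    (φ := fun a b => (if a = d then 1 else 0) - if b = d then 1 else 0) hJ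
  have hv2 := variance_resamplingSum_le (V := Fin n) h0 h1 hJ
    (φ := fun a b => |(if a = d then 1 else 0) - if b = d then 1 else 0|)
    fun a b => by rw [abs_abs]; exact hJ a b
  rw [hreal]
  have := abs_bernoulliMean_sub_gaussianCDF_le_of_variance_le h0 h1
    (E := completeEdges (Fin n)) (B := starEdges)
    (I := fun v S => if edgeDegree S v = d then 1 else 0)
    (X := fun S => ∑ u, if edgeDegree S u = d then 1 else 0)
    (fun v S => by rw [edgeDegree_inter_starEdges]) (fun S => rfl)
    (Real.sqrt_pos.2 hvar) (hV.trans hvar') hv1 hv2 x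
  rwa [hV, Fintype.card_fin] at this

theorem degreeCountDist_le (n d : ℕ) (p : unitInterval)
    (hvar : 0 < Var[degreeCount n d; binomialRandom (Fin n) p]) {Ω : Type*} [MeasurableSpace Ω]
    {P : Measure Ω} {N : Ω → ℝ} (hN : HasLaw N (gaussianReal 0 1) P) :
    degreeCountDist n d p N P ≤
      3 * √(192 * (1 + n * p + 2 * (n * p) ^ 2) * ((n : ℝ) ^ 2 * p)) /
        Var[degreeCount n d; binomialRandom (Fin n) p] := by
  refine ciSup_le fun x => ?_
  have h : P.real {ω | N ω ≤ x} = gaussianCDF x := by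
    rw [gaussianCDF, ← hN.map_eq, measureReal_def, measureReal_def,
      Measure.map_apply_of_aemeasurable hN.aemeasurable measurableSet_Iic]
    rfl
  rw [h]
  exact abs_sub_gaussianCDF_le n d p hvar x

theorem degreeCountDist_nonneg (n d : ℕ) (p : unitInterval) {Ω : Type*} [MeasurableSpace Ω]
    (N : Ω → ℝ) (P : Measure Ω) : 0 ≤ degreeCountDist n d p N P :=
  Real.iSup_nonneg fun _ => abs_nonneg _

theorem le_variance_degreeCount (n : ℕ) (p : unitInterval) {d d' : ℕ} (hd : d ≠ d') :
    n * (((n - 1).choose d * ((p : ℝ) ^ d * (1 - p) ^ (n - 1 - d))) *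
      ((n - 1).choose d' * ((p : ℝ) ^ d' * (1 - p) ^ (n - 1 - d')))) ≤
      Var[degreeCount n d; binomialRandom (Fin n) p] := by
  have h := card_mul_choose_mul_le_variance (V := Fin n) p.2.1 p.2.2 hd
  rw [Fintype.card_fin] at h
  refine h.trans (le_of_eq ?_)
  rw [variance_eq_integral (measurable_of_finite _).aemeasurable, integral_binomialRandom,
    integral_binomialRandom]
  simp only [degreeCount_fromEdgeSet]
  rw [sq_sub_mean]

end BinomialRandomGraph

/-! ### Asymptotic rates -/

section Asymptotics

theorem exp_neg_two_mul_le {p : ℝ} (h0 : 0 ≤ p) (h : p ≤ 1 / 2) : Real.exp (-(2 * p)) ≤ 1 - p := by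
  have hq : 0 < 1 - p := by linarith
  have h1 : (1 - p)⁻¹ ≤ Real.exp (2 * p) := by
    refine le_trans ?_ (Real.add_one_le_exp (2 * p))
    rw [inv_le_iff_one_le_mul₀ hq]
    nlinarith
  rw [Real.exp_neg]
  exact inv_le_of_inv_le₀ hq h1

/-- Each of the `d` factors in the numerator of the binomial coefficient is at least `n - d ≥ n /
2`, and `1 - p ≥ exp (-2p)` for `p ≤ 1 / 2`. -/
theorem le_choose_mul_pow {n d : ℕ} {p : ℝ} (h0 : 0 ≤ p) (h : p ≤ 1 / 2) (hn : 1 ≤ n)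
    (hd : 2 * d ≤ n) :
    (n * p / 2) ^ d / d.factorial * Real.exp (-(2 * (n * p))) ≤
      (n - 1).choose d * (p ^ d * (1 - p) ^ (n - 1 - d)) := by
  have hq : 0 ≤ 1 - p := by linarith
  have h1 : ((n : ℝ) / 2) ^ d / d.factorial ≤ (n - 1).choose d := by
    refine le_trans ?_ (Nat.pow_le_choose (α := ℝ) d (n - 1))
    have : (n : ℝ) / 2 ≤ (n - 1 + 1 - d : ℕ) := by
      rw [Nat.sub_add_cancel hn, Nat.cast_sub (by omega)]
      have : (2 : ℝ) * d ≤ n := by exact_mod_cast hd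
      linarith
    gcongr
  have h2 : Real.exp (-(2 * (n * p))) ≤ (1 - p) ^ (n - 1 - d) := by
    calc Real.exp (-(2 * (n * p))) = Real.exp (-(2 * p)) ^ n := by
          rw [← Real.exp_nat_mul]
          ring_nf
      _ ≤ (1 - p) ^ n := pow_le_pow_left₀ (Real.exp_pos _).le (exp_neg_two_mul_le h0 h) n
      _ ≤ _ := pow_le_pow_of_le_one hq (by linarith) (by omega)
  calc _ = ((n : ℝ) / 2) ^ d / d.factorial * (p ^ d * Real.exp (-(2 * (n * p)))) := by
        rw [mul_div_right_comm, mul_pow]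
        ring
    _ ≤ _ := by gcongr

theorem isBigO_degreeCountDist {Ω : Type*} [MeasurableSpace Ω] {P : Measure Ω} {N : Ω → ℝ}
    (hN : HasLaw N (gaussianReal 0 1) P) {d d' : ℕ} (hd : d ≠ d') {α : ℝ} (hα : 1 ≤ α)
    {θ : ℕ → ℝ} (hθ : θ =Θ[atTop] (fun _ => (1 : ℝ))) (hθ0 : ∀ n : ℕ, 1 ≤ n → 0 < θ n)
    {p : ℕ → unitInterval} (hp : ∀ n : ℕ, 1 ≤ n → (p n : ℝ) = θ n * (n : ℝ) ^ (-α)) :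
    (fun n : ℕ => degreeCountDist n d (p n) N P)
      =O[atTop] (fun n : ℕ => (n : ℝ) ^ (-(1 / 2) + (1 - α) * (1 / 2 - ((d : ℝ) + d')))) := by
  obtain ⟨C, hC, hCb⟩ := hθ.1.exists_pos
  obtain ⟨c, hc, hcb⟩ := hθ.2.exists_pos
  have hκ : 0 < (c⁻¹ / 2) ^ d / d.factorial * ((c⁻¹ / 2) ^ d' / d'.factorial) *
    -- `C` and `c⁻¹` bound `θ` above and below. Each of the two degree probabilities contributes
    -- `exp (-2C)`.
    Real.exp (-(4 * C)) := by positivity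
  set κ := (c⁻¹ / 2) ^ d / d.factorial * ((c⁻¹ / 2) ^ d' / d'.factorial) *
    Real.exp (-(4 * C)) with hκdef
  set A := 3 * √(192 * (1 + C + 2 * C ^ 2) * C) with hA
  refine IsBigO.of_bound (A / κ) ?_
  filter_upwards [hCb.bound, hcb.bound, eventually_ge_atTop 1, eventually_ge_atTop (2 * d),
    eventually_ge_atTop (2 * d'), eventually_ge_atTop ⌈2 * C⌉₊] with n h1 h2 hn hnd hnd' hnC
  rw [norm_one, mul_one, Real.norm_of_nonneg (hθ0 n hn).le] at h1
  rw [norm_one, Real.norm_of_nonneg (hθ0 n hn).le] at h2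
  have hn0 : (0 : ℝ) < n := by exact_mod_cast hn
  have hn1 : (1 : ℝ) ≤ n := by exact_mod_cast hn
  have h3 : c⁻¹ ≤ θ n := by rwa [inv_le_iff_one_le_mul₀' hc]
  set x : ℝ := (n : ℝ) ^ (1 - α) with hx
  have hx0 : 0 < x := Real.rpow_pos_of_pos hn0 _
  have hx1 : x ≤ 1 := Real.rpow_le_one_of_one_le_of_nonpos hn1 (by linarith)
  have hK : n * (p n : ℝ) = θ n * x := by
    rw [hp n hn, hx, sub_eq_add_neg, Real.rpow_add hn0, Real.rpow_one]
    ring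
  set K := n * (p n : ℝ) with hKdef
  have hKl : c⁻¹ * x ≤ K := hK ▸ mul_le_mul_of_nonneg_right h3 hx0.le
  have hKu : K ≤ C * x := hK ▸ mul_le_mul_of_nonneg_right h1 hx0.le
  have hKC : K ≤ C := hKu.trans (mul_le_of_le_one_right hC.le hx1)
  have hK0 : 0 < K := (by positivity : 0 < c⁻¹ * x).trans_le hKl
  have hp0 : 0 ≤ (p n : ℝ) := (p n).2.1
  have hp2 : (p n : ℝ) ≤ 1 / 2 := by
    have : 2 * C ≤ n := Nat.ceil_le.1 hnC
    nlinarith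
  have hb {k : ℕ} (hk : 2 * k ≤ n) : (c⁻¹ * x / 2) ^ k / k.factorial * Real.exp (-(2 * C)) ≤
      (n - 1).choose k * ((p n : ℝ) ^ k * (1 - p n) ^ (n - 1 - k)) := by
    refine le_trans ?_ (le_choose_mul_pow hp0 hp2 hn hk)
    gcongr
  have hvar : κ * (n * x ^ (d + d')) ≤ Var[degreeCount n d; SimpleGraph.binomialRandom (Fin n) (p n)] := by
    refine le_trans ?_ (le_variance_degreeCount n (p n) hd)
    refine le_trans (le_of_eq ?_) (mul_le_mul_of_nonneg_left
      (mul_le_mul (hb hnd) (hb hnd') (by positivity) ?_) hn0.le)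
    · rw [hκdef, show -(4 * C) = -(2 * C) + -(2 * C) by ring, Real.exp_add, pow_add,
        show c⁻¹ * x / 2 = c⁻¹ / 2 * x by ring, mul_pow, mul_pow]
      ring
    · exact le_trans (by positivity) (hb hnd)
  have hpos : 0 < κ * (n * x ^ (d + d')) := by positivity
  have hnum : 3 * √(192 * (1 + n * p n + 2 * (n * p n) ^ 2) * ((n : ℝ) ^ 2 * p n)) ≤
      A * √(n * x) := by
    rw [hA, mul_assoc 3, ← Real.sqrt_mul (by positivity), ← hKdef]
    refine mul_le_mul_of_nonneg_left (Real.sqrt_le_sqrt ?_) (by norm_num)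
    calc _ = 192 * (1 + K + 2 * K ^ 2) * (n * K) := by rw [hKdef]; ring
      _ ≤ 192 * (1 + C + 2 * C ^ 2) * (n * (C * x)) := by gcongr
      _ = _ := by ring
  rw [Real.norm_of_nonneg (degreeCountDist_nonneg _ _ _ _ _),
    Real.norm_of_nonneg (Real.rpow_nonneg hn0.le _)]
  refine (degreeCountDist_le n d (p n) (hpos.trans_le hvar) hN).trans ?_
  refine (div_le_div₀ (by positivity) hnum hpos hvar).trans (le_of_eq ?_)
  have hr : √(n * x) = (n : ℝ) ^ (-(1 / 2) + (1 - α) * (1 / 2 - ((d : ℝ) + d'))) *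
      (n * x ^ (d + d')) := by
    have h (a : ℝ) : (n : ℝ) * (n : ℝ) ^ a = (n : ℝ) ^ (1 + a) := by
      rw [Real.rpow_add hn0, Real.rpow_one]
    rw [Real.sqrt_eq_rpow, hx, ← Real.rpow_natCast, ← Real.rpow_mul hn0.le, h, h,
      ← Real.rpow_mul hn0.le, ← Real.rpow_add hn0]
    congr 1
    push_cast
    ring
  rw [hr]
  field_simp

end Asymptotics

theorem theorem1p3 {Ω : Type*} [MeasurableSpace Ω] (P : Measure Ω) (N : Ω → ℝ)
    (hN : HasLaw N (gaussianReal 0 1) P)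
    (d : ℕ) (α : ℝ) (hα : α ∈ Set.Ico (1 : ℝ) 2)
    (θ : ℕ → ℝ) (hθ : ∀ n : ℕ, 1 ≤ n → θ n ∈ Set.Ioo (0 : ℝ) ((n : ℝ) ^ α))
    (hθ1 : θ =Θ[atTop] (fun _ => (1 : ℝ)))
    (p : ℕ → unitInterval) (hp : ∀ n : ℕ, 1 ≤ n → (p n : ℝ) = θ n * (n : ℝ) ^ (-α)) :
    (d = 0 →
      (fun n : ℕ => degreeCountDist n d (p n) N P)
        =O[atTop] (fun n : ℕ => (n : ℝ) ^ (-1 + α / 2))) ∧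
    (1 ≤ d → α < (3 * (d : ℝ) - 1) / (3 * (d : ℝ) - 2) →
      (fun n : ℕ => degreeCountDist n d (p n) N P)
        =O[atTop] (fun n : ℕ =>
          (n : ℝ) ^ (1 / 2 - 3 * (d : ℝ) / 2 - α + 3 * α * (d : ℝ) / 2))) ∧
    (α = 1 →
      (fun n : ℕ => degreeCountDist n d (p n) N P)
        =O[atTop] (fun n : ℕ => (n : ℝ) ^ (-(1 / 2) : ℝ))) := by
  have key (d' : ℕ) (hd : d ≠ d') :=
    isBigO_degreeCountDist hN hd hα.1 hθ1 (fun n hn => (hθ n hn).1) hp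
  have hmono {a b : ℝ} (hab : a ≤ b) :
      (fun n : ℕ => (n : ℝ) ^ a) =O[atTop] fun n : ℕ => (n : ℝ) ^ b := by
    refine IsBigO.of_bound 1 ((eventually_ge_atTop 1).mono fun n hn => ?_)
    have hn1 : (1 : ℝ) ≤ n := by exact_mod_cast hn
    rw [one_mul, Real.norm_of_nonneg (by positivity), Real.norm_of_nonneg (by positivity)]
    exact Real.rpow_le_rpow_of_exponent_le hn1 hab
  refine ⟨fun hd => ?_, fun hd _ => ?_, fun h1 => ?_⟩
  -- With `d' = 1` the exponents agree.
  · refine (key 1 (by omega)).trans (hmono (le_of_eq ?_))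
    subst hd
    push_cast
    ring
  -- With `d' = 0` the exponent obtained is smaller than the claimed one by `(α - 1) * (d - 1) / 2`,
  -- which is nonnegative.
  · refine (key 0 (by omega)).trans (hmono ?_)
    have h2 : (1 : ℝ) ≤ d := by exact_mod_cast hd
    push_cast
    nlinarith [mul_nonneg (sub_nonneg.2 h2) (sub_nonneg.2 hα.1)]
  -- For `α = 1` the exponent does not depend on `d'`, so any `d' ≠ d` will do.
  · refine (key (d + 1) (by omega)).trans (hmono (le_of_eq ?_))
    subst h1
    ring
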